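/- Let $n\ge 1$, $\alpha=\pi/(2n+1)$, and let $\Delta_0\subseteq\mathbb{E}^2$ be an isosceles triangle with angles $\alpha$ (at the apex), $n\alpha$, $n\alpha$. Let $V$ be the space of affine linear functions $v(x)=\langle a,x\rangle+c$ on $\mathbb{E}^2$ with the bilinear form $(v,v')=\langle a,a'\rangle$, and put $\Pi_v=\{x\mid v(x)<0\}$. The *initial seed* $x_0=(\mathbf v_0,B_0)$ consists of the three functions $v_0,v_1,v_2\in V$ with $(v_i,v_i)=2$ that vanish on the base (index $0$) and on the two legs (indices $1,2$) of $\Delta_0$ and are negative inside $\Delta_0$, and of the skew-symmetric matrix $B_0$ with $b_{01}=b_{02}=2\cos(n\alpha)$ and $b_{12}=2\cos\alpha$ (so the base is the source and leg $2$ is the sink of the quiver). Let $b$ be the line through the feet $H_0,H_2$ of the altitudes of $\Delta_0$ on the sides $0$ and $2$. The reference point is the point infinitely far away on $b$ in the direction from $H_0$ to $H_2$, that is, $v\in V$ is called *positive* if $\Pi_v$ contains $H_0+t(H_2-H_0)$ for all sufficiently large $t$. The *mutation* of $(\mathbf v,B)$ at $k$ is $(\mathbf v',B')$, where $b'_{ij}=-b_{ij}$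 if $k\in\{i,j\}$ and $b'_{ij}=b_{ij}+(b_{ik}|b_{kj}|+|b_{ik}|b_{kj})/2$ otherwise, $v_k'=-v_k$, and for $i\ne k$: if $v_k$ is positive, then $v_i'=v_i$ when $b_{ik}>0$ and $v_i'=v_i-(v_i,v_k)v_k$ otherwise; if $v_k$ is not positive, then $v_i'=v_i$ when $b_{ik}<0$ and $v_i'=v_i-(v_i,v_k)v_k$ otherwise. Seeds that differ by a simultaneous permutation of the indices are identified. The *exchange graph* $\Gamma$ has as vertices all seeds obtained from $x_0$ by sequences of mutations, two of them being adjacent if they are related by a single mutation; it carries the graph distance. For $w\in\mathbb{E}^2$ the translated seed $w+(\mathbf v,B)$ is obtained by replacing each $v_i$ by $x\mapsto v_i(x-w)$. The *translation lattice* $L\subseteq\mathbb{R}$ is the subgroup generated by the lengths $\lVert w\rVert$ of all $w\in\mathbb{E}^2$ for which $\Gamma$ contains two seeds $x,y$ with $x=w+y$; an element $\ell\in L$ is identified with the vector $\ell e$, where $e$ is the unit vector parallel to $b$ pointing from $H_0$ to $H_2$. Then: 1. The map $(w,x)\mapsto w+x$ is a well-defined action of $L$ on $\Gamma$ by graph automorphisms.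 It is isometric, properly discontinuous (for every vertex $x$ and every $\rho\in\mathbb{R}$ only finitely many $w\in L$ satisfy $d(x,w+x)\le \rho$), and has finitely many orbits of vertices. 2. $L$ is finitely generated of rank $r=\operatorname{rk}_{\mathbb{Z}}(L)=\varphi(2n+1)/2$. 3. For every finite symmetric generating set $S\subseteq L\setminus\{0\}$ the map $L\to\Gamma$, $w\mapsto w+x_0$, is a quasi-isometry from the Cayley graph $\operatorname{Cay}_S(L)$ to $\Gamma$. 4. $\Gamma$ is quasi-isometric to $\mathbb{Z}^r$, viewed as the graph in which two lattice points are adjacent if and only if their Euclidean distance is $1$. Here $f\colon M_1\to M_2$ is a *quasi-isometry* if there are $a\ge1$, $b,c\ge0$ with $\frac1a d_1(x,y)-b\le d_2(f(x),f(y))\le a\,d_1(x,y)+b$ for all $x,y\in M_1$, and every point of $M_2$ is at distance at most $c$ from a point of $f(M_1)$. -/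

import Mathlib

namespace AffineExchange

noncomputable section

open Filter

/-- The Euclidean plane. -/
abbrev Plane : Type := EuclideanSpace ℝ (Fin 2)

/-- The three-dimensional quadratic space of affine linear functions on the plane: the pair
`(a, c)` stands for the function `x ↦ ⟪a, x⟫ + c`. -/
abbrev QuadSpace : Type := Plane × ℝ

/-- The affine linear function on the plane given by a vector of the quadratic space. -/
def evalAt (v : QuadSpace) (x : Plane) : ℝ := inner ℝ v.1 x + v.2

/-- The degenerate symmetric bilinear form `(·,·)`; its radical consists of the constants. -/
def form (v w : QuadSpace) : ℝ := inner ℝ v.1 w.1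

/-- The open half-plane `Π_v`. -/
def halfPlane (v : QuadSpace) : Set Plane := {x | evalAt v x < 0}

/-- Mutation of exchange matrices. -/
def mutateMatrix (B : Matrix (Fin 3) (Fin 3) ℝ) (k : Fin 3) : Matrix (Fin 3) (Fin 3) ℝ :=
  fun i j =>
    if i = k ∨ j = k then -B i j
    else B i j + (B i k * |B k j| + |B i k| * B k j) / 2

/-- A pair `(v, B)` of a triple of vectors and an exchange matrix, with numbered entries. -/
structure LabelledSeed where
  /-- the triple of vectors -/
  v : Fin 3 → QuadSpace
  /-- the exchange matrix; there is an arrow `i → j` when `0 < B i j` -/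
  B : Matrix (Fin 3) (Fin 3) ℝ

/-- Two labelled seeds are identified when they differ by a permutation of the entries. -/
instance seedSetoid : Setoid LabelledSeed where
  r s t := ∃ σ : Equiv.Perm (Fin 3), (∀ i, t.v i = s.v (σ i)) ∧ ∀ i j, t.B i j = s.B (σ i) (σ j)
  iseqv :=
    { refl := fun _ => ⟨1, fun _ => rfl, fun _ _ => rfl⟩
      symm := by
        rintro s t ⟨σ, h₁, h₂⟩
        exact ⟨σ⁻¹, fun i => by simp [h₁], fun i j => by simp [h₂]⟩
      trans := by
        rintro s t u ⟨σ, h₁, h₂⟩ ⟨ρ, h₃, h₄⟩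
        exact ⟨σ * ρ, fun i => by simp [h₁, h₃], fun i j => by simp [h₂, h₄]⟩ }

/-- Seeds up to permutation of the entries. -/
abbrev Seed : Type := Quotient seedSetoid

/-- The function `x ↦ v (x - w)`, whose half-plane is the translate of `Π_v` by `w`. -/
def translateVector (w : Plane) (v : QuadSpace) : QuadSpace := (v.1, v.2 - inner ℝ v.1 w)

/-- The translated seed `w + (v, B)`, for labelled seeds. -/
def LabelledSeed.translate (w : Plane) (s : LabelledSeed) : LabelledSeed where
  v i := translateVector w (s.v i)
  B := s.B

/-- The translated seed `w + (v, B)`. -/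
def translate (w : Plane) : Seed → Seed :=
  Quotient.map (LabelledSeed.translate w) (by
    rintro s t ⟨σ, h₁, h₂⟩
    exact ⟨σ, fun i => by simp [LabelledSeed.translate, h₁],
      fun i j => by simp [LabelledSeed.translate, h₂]⟩)

/-- The initial triangle: isosceles with angles `α`, `n α`, `n α`, where `α = π / (2 n + 1)`.
The vertex with index `0` is the apex. -/
def IsInitialTriangle (n : ℕ) (T : Affine.Triangle ℝ Plane) : Prop :=
  EuclideanGeometry.angle (T.points 1) (T.points 0) (T.points 2) = Real.pi / (2 * n + 1) ∧
  EuclideanGeometry.angle (T.points 0) (T.points 1) (T.points 2) = n * (Real.pi / (2 * n + 1)) ∧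
  EuclideanGeometry.angle (T.points 0) (T.points 2) (T.points 1) = n * (Real.pi / (2 * n + 1))

/-- The vector of length `√2` perpendicular to the side opposite to the vertex `i`, pointing out
of the triangle. -/
def outerNormal (T : Affine.Triangle ℝ Plane) (i : Fin 3) : Plane :=
  (√2 / ‖T.altitudeFoot i - T.points i‖) • (T.altitudeFoot i - T.points i)

/-- The vector of the quadratic space that belongs to the side opposite to the vertex `i`: it
vanishes on this side, and the triangle lies in its half-plane. -/
def sideVector (T : Affine.Triangle ℝ Plane) (i : Fin 3) : QuadSpace :=
  (outerNormal T i, -inner ℝ (outerNormal T i) (T.altitudeFoot i))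

/-- The exchange matrix of the initial seed: up to sign, its entries are `2 cos` of the angles
between the sides, and the quiver is `0 → 1`, `0 → 2`, `1 → 2`, so that the base `0` is the source
and the leg `2` is the sink. -/
def initialMatrix (n : ℕ) : Matrix (Fin 3) (Fin 3) ℝ :=
  let α : ℝ := Real.pi / (2 * n + 1)
  !![0, 2 * Real.cos (n * α), 2 * Real.cos (n * α);
     -(2 * Real.cos (n * α)), 0, 2 * Real.cos α;
     -(2 * Real.cos (n * α)), -(2 * Real.cos α), 0]

/-- The initial seed. -/
def initialSeed (n : ℕ) (T : Affine.Triangle ℝ Plane) : Seed :=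
  Quotient.mk _ ⟨sideVector T, initialMatrix n⟩

/-- The belt line `b` passes through the feet of the altitudes on the source (side `0`) and on the
sink (side `2`); this is its parametrisation in the direction from the source to the sink. -/
def beltLine (T : Affine.Triangle ℝ Plane) (t : ℝ) : Plane :=
  AffineMap.lineMap (T.altitudeFoot 0) (T.altitudeFoot 2) t

/-- The unit vector parallel to the belt line, in the direction from the source to the sink. -/
def beltDirection (T : Affine.Triangle ℝ Plane) : Plane :=
  (1 / ‖T.altitudeFoot 2 - T.altitudeFoot 0‖) • (T.altitudeFoot 2 - T.altitudeFoot 0)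

/-- A vector is positive if its half-plane contains the reference point, which lies infinitely far
away on the belt line, in the direction from the source to the sink: the half-plane contains all
points of the belt line that are far enough in this direction. -/
def IsPositive (T : Affine.Triangle ℝ Plane) (v : QuadSpace) : Prop :=
  ∀ᶠ t : ℝ in atTop, beltLine T t ∈ halfPlane v

open Classical in
/-- Mutation of labelled seeds. -/
def LabelledSeed.mutate (T : Affine.Triangle ℝ Plane) (s : LabelledSeed) (k : Fin 3) :
    LabelledSeed where
  v i :=
    if i = k then -s.v i
    else if IsPositive T (s.v k) then
      if 0 < s.B i k then s.v i else s.v i - form (s.v i) (s.v k) • s.v k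
    else
      if s.B i k < 0 then s.v i else s.v i - form (s.v i) (s.v k) • s.v k
  B := mutateMatrix s.B k

/-- The seed `y` is obtained from the seed `x` by a single mutation. -/
def IsMutation (T : Affine.Triangle ℝ Plane) (x y : Seed) : Prop :=
  ∃ (s : LabelledSeed) (k : Fin 3), x = Quotient.mk _ s ∧ y = Quotient.mk _ (s.mutate T k)

/-- The seeds obtained from the initial seed by sequences of mutations. -/
def ExchangeVertex (n : ℕ) (T : Affine.Triangle ℝ Plane) : Type :=
  {x : Seed // Relation.ReflTransGen (IsMutation T) (initialSeed n T) x}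

/-- The initial seed as a vertex of the exchange graph. -/
def initialVertex (n : ℕ) (T : Affine.Triangle ℝ Plane) : ExchangeVertex n T :=
  ⟨initialSeed n T, Relation.ReflTransGen.refl⟩

/-- The exchange graph of the initial seed. -/
def exchangeGraph (n : ℕ) (T : Affine.Triangle ℝ Plane) : SimpleGraph (ExchangeVertex n T) :=
  SimpleGraph.fromRel fun x y => IsMutation T x.1 y.1

/-- The exchange graph is connected, so its graph distance is a genuine metric. -/
theorem exchangeGraph_connected (n : ℕ) (T : Affine.Triangle ℝ Plane) :
    (exchangeGraph n T).Connected := by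
  have key : ∀ x : Seed, ∀ hx : Relation.ReflTransGen (IsMutation T) (initialSeed n T) x,
      (exchangeGraph n T).Reachable (initialVertex n T) ⟨x, hx⟩ := by
    intro x hx
    induction hx with
    | refl => exact SimpleGraph.Reachable.refl _
    | @tail y z hy hyz ih =>
      by_cases h : y = z
      · subst h; exact ih
      · refine ih.trans (SimpleGraph.Adj.reachable ?_)
        refine (SimpleGraph.fromRel_adj _ _ _).2 ⟨fun e => h (congrArg Subtype.val e), Or.inl hyz⟩
  exact (SimpleGraph.connected_iff _).2
    ⟨fun x y => (key x.1 x.2).symm.trans (key y.1 y.2), ⟨initialVertex n T⟩⟩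

/-- The translation lattice `L`: the subgroup of `ℝ` generated by the lengths of all vectors that
translate one seed of the exchange graph into another one. -/
def translationLattice (n : ℕ) (T : Affine.Triangle ℝ Plane) : AddSubgroup ℝ :=
  AddSubgroup.closure
    {l : ℝ | ∃ (w : Plane) (x y : ExchangeVertex n T), x.1 = translate w y.1 ∧ l = ‖w‖}

/-- Quasi-isometries between sets with distance functions. -/
def IsQuasiIsometry {M₁ M₂ : Type*} (d₁ : M₁ → M₁ → ℝ) (d₂ : M₂ → M₂ → ℝ) (f : M₁ → M₂) : Prop :=
  (∃ a b : ℝ, 1 ≤ a ∧ 0 ≤ b ∧ ∀ x y,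
    1 / a * d₁ x y - b ≤ d₂ (f x) (f y) ∧ d₂ (f x) (f y) ≤ a * d₁ x y + b) ∧
  ∃ c : ℝ, 0 ≤ c ∧ ∀ z, ∃ x, d₂ z (f x) ≤ c

/-- The real-valued distance between two vertices of a graph. -/
def graphDist {M : Type*} (G : SimpleGraph M) (x y : M) : ℝ := (G.dist x y : ℝ)

/-- The graph `ℤ^r`: two lattice points are adjacent if their Euclidean distance is `1`. -/
def integerLatticeGraph (r : ℕ) : SimpleGraph (Fin r → ℤ) where
  Adj x y := ∑ i, (x i - y i) ^ 2 = 1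
  symm := ⟨fun x y h => by
    rw [← h]
    exact Finset.sum_congr rfl fun i _ => by ring⟩
  loopless := ⟨fun x h => by simp at h⟩

end

end AffineExchange

/-! A seed of Γ is described by four data: an orientation, two angles aα and bα, and the position p
at which one of its lines crosses the belt line b. The triangle has angles aα, bα and π - (a+b)α. It
is obtuse (or a strip, if b = 0) and the quiver cyclic for a + b ≤ n; it is acute and the quiver
acyclic for a + b > n.

In these coordinates mutation is a Euclidean algorithm (`isMutation_seedOf_iff`). For a + b ≤ n, (a,
b) becomes (a, a + b) with p fixed, or (a + b, b). For a + b > n it becomes (2n + 1 - (a + b), a) in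
the mirrored frame. In the last two cases p drops by K cos(bα) / (sin(aα) sin((a+b)α)) for a fixed
length K. All other mutations are inverses of these.

The rules do not involve p, so shifts along b commute with mutation. The data of a seed are unique
(`eq_shift_of_seedOf_eq_translate`), hence L is the group `periods` of all u for which the initial
seed shifted by u is reachable (`translationLattice_eq`). There are finitely many triples
(orientation, a, b), hence finitely many orbits. The action is free and Γ is connected of finite
valency, so balls are finite and the action is proper; the Švarc–Milnor lemma
`exists_quasiIsometries` then gives both quasi-isometries.

The rank is bounded above because the position changes, divided by K, lie in the real part of
ℚ(exp(iα)), of dimension at most φ(2n+1)/2. For the lower bound, when k is prime to 2n + 1 the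
Euclidean algorithm reaches the strip (k, 0), which a mutation translates by K / sin²(kα). These
φ(2n+1)/2 numbers are independent over ℚ (`linearIndependent_cosecSq`): in a relation, a Galois
conjugation moves the coefficient of largest modulus to 1 / sin² α, which exceeds the sum of all 1 /
sin²(mα) with 2 ≤ m ≤ n. -/

namespace AffineExchange

/-! ### Coarse geometry of graphs and the Švarc–Milnor lemma. -/

section CoarseGeometry

/-- A map between graphs that moves adjacent vertices to vertices at bounded distance is
Lipschitz. -/
theorem dist_map_le_mul_dist {M N : Type*} {G : SimpleGraph M} {H : SimpleGraph N}
    (hG : G.Connected) (hH : H.Connected) (f : M → N) (C : ℕ)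
    (hf : ∀ x y, G.Adj x y → H.dist (f x) (f y) ≤ C) (x y : M) :
    H.dist (f x) (f y) ≤ C * G.dist x y := by
  have key : ∀ {u v : M} (p : G.Walk u v), H.dist (f u) (f v) ≤ C * p.length := by
    intro u v p
    induction p with
    | nil => simp
    | cons h p ih =>
      refine (hH.dist_triangle).trans ((add_le_add (hf _ _ h) ih).trans ?_)
      rw [SimpleGraph.Walk.length_cons]
      exact le_of_eq (by ring)
  obtain ⟨p, hp⟩ := hG.exists_walk_length_eq_dist x y
  rw [← hp]
  exact key p

/-- A Lipschitz map with a coarse Lipschitz inverse is a quasi-isometry. -/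
theorem isQuasiIsometry_of_coarse_inverse {M N : Type*} {G : SimpleGraph M} {H : SimpleGraph N}
    (hG : G.Connected) (f : M → N) (h : N → M) (C₁ C₂ D E : ℕ)
    (hf : ∀ x y, H.dist (f x) (f y) ≤ C₁ * G.dist x y)
    (hh : ∀ x y, G.dist (h x) (h y) ≤ C₂ * H.dist x y)
    (hfh : ∀ x, H.dist x (f (h x)) ≤ D) (hhf : ∀ x, G.dist x (h (f x)) ≤ E) :
    IsQuasiIsometry (graphDist G) (graphDist H) f := by
  -- The lower bound is d(x, y) ≤ d(h f x, h f y) + 2E ≤ C₂ d(f x, f y) + 2E; the constant `C₁ + C₂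
  -- + 1` dominates 1, `C₁` and `C₂` at once.
  refine ⟨⟨C₁ + C₂ + 1, 2 * E, le_add_of_nonneg_left (by positivity), by positivity,
    fun x y => ⟨?_, ?_⟩⟩, D, by positivity, fun z => ⟨h z, Nat.cast_le.2 (hfh z)⟩⟩
  · have h₁ : G.dist x y ≤ E + (C₂ * H.dist (f x) (f y) + E) := by
      refine (hG.dist_triangle (v := h (f x))).trans (add_le_add (hhf x) ?_)
      refine (hG.dist_triangle (v := h (f y))).trans (add_le_add (hh _ _) ?_)
      rw [SimpleGraph.dist_comm]
      exact hhf y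
    have h₂ : (G.dist x y : ℝ) ≤ E + (C₂ * H.dist (f x) (f y) + E) := by exact_mod_cast h₁
    simp only [graphDist]
    have ha : (0 : ℝ) < C₁ + C₂ + 1 := by positivity
    rw [sub_le_iff_le_add, one_div, inv_mul_le_iff₀ ha]
    refine h₂.trans ?_
    have p₁ : (0 : ℝ) ≤ (C₁ : ℝ) * H.dist (f x) (f y) := by positivity
    have p₂ : (0 : ℝ) ≤ (C₁ : ℝ) * E := by positivity
    have p₃ : (0 : ℝ) ≤ (C₂ : ℝ) * E := by positivity
    have p₄ : (0 : ℝ) ≤ (H.dist (f x) (f y) : ℝ) := by positivity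
    nlinarith
  · have h₁ : (H.dist (f x) (f y) : ℝ) ≤ C₁ * G.dist x y := by exact_mod_cast hf x y
    simp only [graphDist]
    refine h₁.trans ?_
    have p₁ : (0 : ℝ) ≤ ((C₂ : ℝ) + 1) * G.dist x y := by positivity
    have p₂ : (0 : ℝ) ≤ (E : ℝ) := by positivity
    nlinarith

/-- The distance function of a graph on a group whose adjacency relation is translation invariant
is translation invariant. -/
theorem dist_eq_dist_neg_add {A : Type*} [AddGroup A] {H : SimpleGraph A}
    (hinv : ∀ d u v, H.Adj u v → H.Adj (d + u) (d + v)) (u v : A) :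
    H.dist u v = H.dist 0 (-u + v) := by
  have key : ∀ d x y : A, H.dist (d + x) (d + y) = H.dist x y := fun d x y => by
    let φ : H ≃g H :=
      { toEquiv := Equiv.addLeft d
        map_rel_iff' := fun {a b} => ⟨fun h => by simpa using hinv (-d) _ _ h, hinv d a b⟩ }
    -- Connectedness is not assumed, so the comparison is made for the extended distance, an infimum
    -- over walks, and passed to `dist` at the end.
    have h₁ : ∀ (ψ : H ≃g H) (x y : A), H.edist (ψ x) (ψ y) ≤ H.edist x y := fun ψ x y => by
      rw [H.edist_eq_sInf]
      conv_rhs => rw [SimpleGraph.edist_eq_sInf]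
      refine le_sInf ?_
      rintro _ ⟨p, rfl⟩
      refine sInf_le ⟨p.map ψ.toHom, by simp⟩
    have h₂ : H.edist (φ x) (φ y) = H.edist x y := by
      refine le_antisymm (h₁ φ x y) ?_
      simpa using h₁ φ.symm (φ x) (φ y)
    exact congrArg ENat.toNat h₂
  rw [← key (-u) u v, neg_add_cancel]

/-- A translation invariant graph on a group is connected as soon as the vertices that can be
reached from `0` generate the group. -/
theorem connected_of_closure_reachable {A : Type*} [AddGroup A] {H : SimpleGraph A}
    (hinv : ∀ d u v, H.Adj u v → H.Adj (d + u) (d + v)) (S : Set A)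
    (hS : ∀ s ∈ S, H.Reachable 0 s) (hcl : AddSubgroup.closure S = ⊤) : H.Connected := by
  have tr : ∀ d u v, H.Reachable u v → H.Reachable (d + u) (d + v) := by
    rintro d u v ⟨p⟩
    exact ⟨p.map ⟨fun x => d + x, fun h => hinv d _ _ h⟩⟩
  let R : AddSubgroup A :=
    { carrier := {x | H.Reachable 0 x}
      zero_mem' := SimpleGraph.Reachable.refl _
      add_mem' := fun {a b} ha hb => SimpleGraph.Reachable.trans ha (by simpa using tr a 0 b hb)
      neg_mem' := fun {a} ha => by simpa using (tr (-a) 0 a ha).symm }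
  have hR : R = ⊤ := by
    rw [eq_top_iff, ← hcl, AddSubgroup.closure_le]
    exact hS
  have h0 : ∀ x, H.Reachable 0 x := fun x => by
    have : x ∈ R := hR ▸ AddSubgroup.mem_top x
    exact this
  exact (SimpleGraph.connected_iff _).2 ⟨fun x y => (h0 x).symm.trans (h0 y), ⟨0⟩⟩

/-- The Švarc–Milnor lemma, for a translation invariant connected graph of finite valency on a
group that acts on a connected graph. -/
theorem exists_quasiIsometries {A M : Type*} [AddGroup A] {H : SimpleGraph A} {G : SimpleGraph M}
    (hH : H.Connected) (hinv : ∀ d u v, H.Adj u v → H.Adj (d + u) (d + v))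
    (hnbr : {s | H.Adj 0 s}.Finite) (hG : G.Connected) (act : A → M → M)
    (act_add : ∀ u v x, act (u + v) x = act u (act v x))
    (isom : ∀ w x y, G.dist (act w x) (act w y) = G.dist x y)
    (proper : ∀ (x : M) (m : ℕ), {w | G.dist x (act w x) ≤ m}.Finite)
    (cocompact : ∃ F : Set M, F.Finite ∧ ∀ x, ∃ y ∈ F, ∃ w, act w y = x) (x₀ : M) :
    IsQuasiIsometry (graphDist H) (graphDist G) (fun w => act w x₀) ∧
      ∃ h : M → A, IsQuasiIsometry (graphDist G) (graphDist H) h := by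
  have step : ∀ u v, G.dist (act u x₀) (act v x₀) = G.dist x₀ (act (-u + v) x₀) := fun u v => by
    rw [← isom u x₀, ← act_add, add_neg_cancel_left]
  obtain ⟨C₁, hC₁⟩ : ∃ C, ∀ s, H.Adj 0 s → G.dist x₀ (act s x₀) ≤ C := by
    obtain ⟨C, hC⟩ := (hnbr.image fun s => G.dist x₀ (act s x₀)).bddAbove
    exact ⟨C, fun s hs => hC ⟨s, hs, rfl⟩⟩
  obtain ⟨F, hF, hcov⟩ := cocompact
  obtain ⟨D, hD⟩ : ∃ D, ∀ y ∈ F, G.dist x₀ y ≤ D := by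
    obtain ⟨C, hC⟩ := (hF.image fun y => G.dist x₀ y).bddAbove
    exact ⟨C, fun s hs => hC ⟨s, hs, rfl⟩⟩
  have near : ∀ x, ∃ w, G.dist (act w x₀) x ≤ D := fun x => by
    obtain ⟨y, hy, w, rfl⟩ := hcov x
    exact ⟨w, (isom w x₀ y).trans_le (hD y hy)⟩
  choose h hh using near
  -- Orbit points chosen within `D` of two adjacent vertices are at distance at most `D + (1 + D)`;
  -- properness leaves only finitely many group elements for such a pair, up to translation.
  obtain ⟨C₂, hC₂⟩ : ∃ C, ∀ w, G.dist x₀ (act w x₀) ≤ D + (1 + D) → H.dist 0 w ≤ C := by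
    obtain ⟨C, hC⟩ := ((proper x₀ (D + (1 + D))).image fun w => H.dist 0 w).bddAbove
    exact ⟨C, fun s hs => hC ⟨s, hs, rfl⟩⟩
  have close : ∀ u v, G.dist (act u x₀) (act v x₀) ≤ D + (1 + D) → H.dist u v ≤ C₂ :=
    fun u v huv => by
      rw [dist_eq_dist_neg_add hinv]
      exact hC₂ _ (by rwa [← step])
  have lipf := dist_map_le_mul_dist hH hG (fun w => act w x₀) C₁ fun u v huv => by
    simp only [step]
    exact hC₁ _ (by simpa using hinv (-u) _ _ huv)
  have liph := dist_map_le_mul_dist hG hH h C₂ fun x y hxy => by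
    refine close _ _ ?_
    refine (hG.dist_triangle (v := x)).trans (add_le_add (hh x) ?_)
    refine (hG.dist_triangle (v := y)).trans
      (add_le_add (SimpleGraph.dist_eq_one_iff_adj.2 hxy).le ?_)
    rw [SimpleGraph.dist_comm]
    exact hh y
  have hfh : ∀ x, G.dist x (act (h x) x₀) ≤ D := fun x => by
    rw [SimpleGraph.dist_comm]
    exact hh x
  have hhf : ∀ w, H.dist w (h (act w x₀)) ≤ C₂ := fun w =>
    close _ _ ((hfh _).trans (by omega))
  exact ⟨isQuasiIsometry_of_coarse_inverse hH _ h C₁ C₂ D C₂ lipf liph hfh hhf,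
    h, isQuasiIsometry_of_coarse_inverse hG h _ C₂ C₁ C₂ D liph lipf hhf hfh⟩

/-- In a graph of finite valency all balls are finite. -/
theorem finite_ball {M : Type*} {G : SimpleGraph M} (hG : G.Connected)
    (hfin : ∀ x, {y | G.Adj x y}.Finite) (x : M) (m : ℕ) : {y | G.dist x y ≤ m}.Finite := by
  -- Walks of bounded length, unlike distances, allow the first edge to be split off in the
  -- induction.
  have key : ∀ m : ℕ, ∀ x, {y | ∃ p : G.Walk x y, p.length ≤ m}.Finite := by
    intro m
    induction m with
    | zero =>
      intro x
      refine (Set.finite_singleton x).subset ?_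
      rintro y ⟨p, hp⟩
      exact (SimpleGraph.Walk.eq_of_length_eq_zero (Nat.le_zero.1 hp)).symm
    | succ m ih =>
      intro x
      refine ((Set.finite_singleton x).union ((hfin x).biUnion fun z _ => ih z)).subset ?_
      rintro y ⟨p, hp⟩
      cases p with
      | nil => exact Or.inl rfl
      | cons h p =>
        refine Or.inr (Set.mem_biUnion h ⟨p, ?_⟩)
        simpa using hp
  refine (key m x).subset fun y hy => ?_
  obtain ⟨p, hp⟩ := hG.exists_walk_length_eq_dist x y
  exact ⟨p, hp.trans_le hy⟩

theorem addCayley_connected {A : Type*} [AddGroup A] (S : Set A)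
    (hS : AddSubgroup.closure S = ⊤) : (SimpleGraph.addCayley S).Connected := by
  refine connected_of_closure_reachable
    (fun d u v h => SimpleGraph.addCayley_adj_add_iff_right.2 h) S (fun s hs => ?_) hS
  by_cases h0 : s = 0
  · rw [h0]
  · refine SimpleGraph.Adj.reachable ((SimpleGraph.addCayley_adj' S 0 s).2 ⟨Ne.symm h0, s, hs, ?_⟩)
    simp

theorem finite_addCayley_adj_zero {A : Type*} [AddGroup A] (S : Set A) (hS : S.Finite) :
    {s | (SimpleGraph.addCayley S).Adj 0 s}.Finite := by
  refine (hS.union (hS.image fun s => -s)).subset ?_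
  intro s hs
  obtain ⟨-, g, hg, h | h⟩ := (SimpleGraph.addCayley_adj' S 0 s).1 hs
  · left
    rwa [← h, zero_add]
  · right
    exact ⟨g, hg, (eq_neg_of_add_eq_zero_left h.symm).symm⟩

theorem integerLatticeGraph_adj_add {r : ℕ} (d u v : Fin r → ℤ)
    (h : (integerLatticeGraph r).Adj u v) : (integerLatticeGraph r).Adj (d + u) (d + v) := by
  simpa [integerLatticeGraph] using h

theorem integerLatticeGraph_connected (r : ℕ) : (integerLatticeGraph r).Connected := by
  refine connected_of_closure_reachable integerLatticeGraph_adj_add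
    (Set.range fun i => Pi.single i 1) ?_ ?_
  · rintro _ ⟨i, rfl⟩
    refine SimpleGraph.Adj.reachable ?_
    simp [integerLatticeGraph, Pi.single_apply, ite_pow]
  · rw [eq_top_iff]
    intro x _
    rw [← Finset.univ_sum_single x]
    refine AddSubgroup.sum_mem _ fun i _ => ?_
    have : (Pi.single i (x i) : Fin r → ℤ) = x i • Pi.single i 1 := by
      rw [← Pi.single_smul]; simp
    rw [this]
    exact AddSubgroup.zsmul_mem _ (AddSubgroup.subset_closure (Set.mem_range_self i)) _

theorem finite_integerLatticeGraph_adj_zero (r : ℕ) :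
    {s | (integerLatticeGraph r).Adj 0 s}.Finite := by
  refine (Set.Finite.pi' (t := fun _ : Fin r => Set.Icc (-1 : ℤ) 1)
    fun _ => Set.finite_Icc _ _).subset ?_
  intro s hs i
  have h : ∑ i, (s i) ^ 2 = 1 := by simpa [integerLatticeGraph] using hs
  have h1 : (s i) ^ 2 ≤ 1 := by
    rw [← h]
    exact Finset.single_le_sum (fun j _ => sq_nonneg (s j)) (Finset.mem_univ i)
  exact ⟨by nlinarith, by nlinarith⟩

end CoarseGeometry

end AffineExchange

/-! ### Coordinates along the belt line, and the normal form of a seed. -/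

namespace AffineExchange

open Real Filter

noncomputable section

variable {T : Affine.Triangle ℝ Plane}

/-- Two labelled seeds that agree after renumbering have the same class. -/
theorem mk_eq_mk_of_perm {s t : LabelledSeed} (σ : Equiv.Perm (Fin 3))
    (hv : ∀ i, t.v i = s.v (σ i)) (hB : ∀ i j, t.B i j = s.B (σ i) (σ j)) :
    (Quotient.mk _ s : Seed) = Quotient.mk _ t :=
  Quotient.sound ⟨σ, hv, hB⟩

theorem mutate_v_self (s : LabelledSeed) (k : Fin 3) : (s.mutate T k).v k = -s.v k := by
  simp [LabelledSeed.mutate]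

theorem mutate_v_of_pos_of_lt {s : LabelledSeed} {i k : Fin 3} (h : IsPositive T (s.v k))
    (hik : i ≠ k) (hB : 0 < s.B i k) : (s.mutate T k).v i = s.v i := by
  simp [LabelledSeed.mutate, h, hik, hB]

theorem mutate_v_of_pos_of_not_lt {s : LabelledSeed} {i k : Fin 3} (h : IsPositive T (s.v k))
    (hik : i ≠ k) (hB : ¬ 0 < s.B i k) :
    (s.mutate T k).v i = s.v i - form (s.v i) (s.v k) • s.v k := by
  simp [LabelledSeed.mutate, h, hik, hB]

theorem mutate_v_of_not_pos_of_lt {s : LabelledSeed} {i k : Fin 3} (h : ¬ IsPositive T (s.v k))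
    (hik : i ≠ k) (hB : s.B i k < 0) : (s.mutate T k).v i = s.v i := by
  simp [LabelledSeed.mutate, h, hik, hB]

theorem mutate_v_of_not_pos_of_not_lt {s : LabelledSeed} {i k : Fin 3}
    (h : ¬ IsPositive T (s.v k)) (hik : i ≠ k) (hB : ¬ s.B i k < 0) :
    (s.mutate T k).v i = s.v i - form (s.v i) (s.v k) • s.v k := by
  simp [LabelledSeed.mutate, h, hik, hB]

/-- Mutation commutes with renumbering. -/
theorem mutate_perm {s t : LabelledSeed} (σ : Equiv.Perm (Fin 3))
    (hv : ∀ i, t.v i = s.v (σ i)) (hB : ∀ i j, t.B i j = s.B (σ i) (σ j)) (k : Fin 3) :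
    (Quotient.mk _ (s.mutate T (σ k)) : Seed) = Quotient.mk _ (t.mutate T k) := by
  refine mk_eq_mk_of_perm σ (fun i => ?_) fun i j => ?_
  · have hk : IsPositive T (t.v k) ↔ IsPositive T (s.v (σ k)) := by rw [hv]
    by_cases h : IsPositive T (t.v k)
    · simp [LabelledSeed.mutate, hv, hB, hk.1 h]
    · simp [LabelledSeed.mutate, hv, hB, mt hk.2 h]
  · simp [LabelledSeed.mutate, mutateMatrix, hB]

/-- The mutations of a class can be read off from any one numbering, so a seed has at most three of
them. -/
theorem isMutation_mk_iff (s : LabelledSeed) (y : Seed) :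
    IsMutation T (Quotient.mk _ s) y ↔ ∃ k, y = Quotient.mk _ (s.mutate T k) := by
  constructor
  · rintro ⟨s', k, h, rfl⟩
    obtain ⟨σ, hv, hB⟩ := Quotient.exact h
    exact ⟨σ k, (mutate_perm σ hv hB k).symm⟩
  · rintro ⟨k, rfl⟩
    exact ⟨s, k, rfl, rfl⟩

/-- An orthonormal frame whose first vector is the direction of the belt line and whose origin
lies on the belt line, together with the unit of length `K` in which the seeds are measured. -/
structure BeltFrame (T : Affine.Triangle ℝ Plane) where
  /-- the direction of the belt line -/
  e : Plane
  /-- the normal of the belt line -/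
  f : Plane
  /-- the origin -/
  O : Plane
  /-- the unit of length -/
  K : ℝ
  /-- the speed of the parametrisation of the belt line -/
  r : ℝ
  inner_e_e : inner ℝ e e = (1 : ℝ)
  inner_f_f : inner ℝ f f = (1 : ℝ)
  inner_e_f : inner ℝ e f = (0 : ℝ)
  K_pos : 0 < K
  r_pos : 0 < r
  beltLine_eq : ∀ t, beltLine T t = O + (t * r) • e

namespace BeltFrame

/-- The mirror image of a frame in the belt line. -/
def flip (F : BeltFrame T) : BeltFrame T where
  e := F.e
  f := -F.f
  O := F.O
  K := F.K
  r := F.r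
  inner_e_e := F.inner_e_e
  inner_f_f := by simpa using F.inner_f_f
  inner_e_f := by simpa using F.inner_e_f
  K_pos := F.K_pos
  r_pos := F.r_pos
  beltLine_eq := F.beltLine_eq

theorem flip_flip (F : BeltFrame T) : F.flip.flip = F := by
  simp [flip]

/-- The outer normal `√2 (sin θ, -cos θ)`. -/
def normal (F : BeltFrame T) (θ : ℝ) : Plane := √2 • (sin θ • F.e - cos θ • F.f)

/-- The vector of the quadratic space with outer normal `√2 (sin θ, -cos θ)` and value `√2 c` at
the origin. -/
def vec (F : BeltFrame T) (θ c : ℝ) : QuadSpace :=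
  (F.normal θ, √2 * c - inner ℝ (F.normal θ) F.O)

variable (F : BeltFrame T)

theorem vec_congr {θ θ' c c' : ℝ} (hs : sin θ = sin θ') (hc : cos θ = cos θ') (h : c = c') :
    F.vec θ c = F.vec θ' c' := by
  simp [vec, normal, hs, hc, h]

theorem neg_vec (θ c : ℝ) : -F.vec θ c = F.vec (θ + π) (-c) := by
  have h : F.normal (θ + π) = -F.normal θ := by
    simp only [normal, sin_add_pi, cos_add_pi]
    module
  simp only [vec, h, Prod.neg_mk, inner_neg_left]
  congr 1
  ring

theorem flip_vec (θ c : ℝ) : F.flip.vec θ c = F.vec (π - θ) c := by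
  have h : F.flip.normal θ = F.normal (π - θ) := by
    simp only [normal, sin_pi_sub, cos_pi_sub, flip]
    module
  simp only [vec, h]
  rfl

theorem inner_f_e : inner ℝ F.f F.e = (0 : ℝ) := by
  rw [real_inner_comm, F.inner_e_f]

theorem inner_normal_e (θ : ℝ) : inner ℝ (F.normal θ) F.e = √2 * sin θ := by
  simp only [normal, inner_smul_left, inner_sub_left, F.inner_e_e, F.inner_f_e]
  simp

theorem inner_normal_f (θ : ℝ) : inner ℝ (F.normal θ) F.f = -(√2 * cos θ) := by
  simp only [normal, inner_smul_left, inner_sub_left, F.inner_e_f, F.inner_f_f]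
  simp

theorem inner_normal_normal (θ θ' : ℝ) :
    inner ℝ (F.normal θ) (F.normal θ') = 2 * cos (θ - θ') := by
  conv_lhs => rw [show F.normal θ' = √2 • (sin θ' • F.e - cos θ' • F.f) from rfl]
  simp only [inner_smul_right, inner_sub_right, F.inner_normal_e, F.inner_normal_f, cos_sub]
  have : √2 * √2 = (2 : ℝ) := mul_self_sqrt (by norm_num)
  linear_combination (sin θ * sin θ' + cos θ * cos θ') * this

theorem form_vec (θ c θ' c' : ℝ) : form (F.vec θ c) (F.vec θ' c') = 2 * cos (θ - θ') :=
  F.inner_normal_normal θ θ'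

/-- Reflection in a line of angle θ' turns the angle θ into 2θ' - θ and interchanges the two sides
of a directed line; this accounts for the summand π. -/
theorem vec_sub_form (θ c θ' c' : ℝ) :
    F.vec θ c - form (F.vec θ c) (F.vec θ' c') • F.vec θ' c' =
      F.vec (2 * θ' - θ + π) (c - 2 * cos (θ - θ') * c') := by
  have h : F.normal (2 * θ' - θ + π) = F.normal θ - (2 * cos (θ - θ')) • F.normal θ' := by
    have h₁ : sin (2 * θ' - θ) = 2 * cos (θ - θ') * sin θ' - sin θ := by
      obtain ⟨d, rfl⟩ : ∃ d, θ = θ' + d := ⟨θ - θ', by ring⟩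
      rw [show 2 * θ' - (θ' + d) = θ' - d by ring, show θ' + d - θ' = d by ring, sin_sub, sin_add]
      ring
    have h₂ : cos (2 * θ' - θ) = 2 * cos (θ - θ') * cos θ' - cos θ := by
      obtain ⟨d, rfl⟩ : ∃ d, θ = θ' + d := ⟨θ - θ', by ring⟩
      rw [show 2 * θ' - (θ' + d) = θ' - d by ring, show θ' + d - θ' = d by ring, cos_sub, cos_add]
      ring
    simp only [normal, sin_add_pi, cos_add_pi, h₁, h₂]
    module
  rw [form_vec]
  simp only [vec, h, Prod.smul_mk, Prod.mk_sub_mk, inner_sub_left, inner_smul_left, smul_eq_mul]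
  congr 1
  simp
  ring

theorem evalAt_vec (θ c s : ℝ) : evalAt (F.vec θ c) (F.O + s • F.e) = √2 * (sin θ * s + c) := by
  simp only [evalAt, vec, inner_add_right, inner_smul_right, F.inner_normal_e]
  ring

theorem isPositive_iff (θ c : ℝ) :
    IsPositive T (F.vec θ c) ↔ ∀ᶠ t : ℝ in atTop, sin θ * (t * F.r) + c < 0 := by
  have h2 : (0 : ℝ) < √2 := by positivity
  simp only [IsPositive, F.beltLine_eq, halfPlane, Set.mem_ofPred_eq, evalAt_vec]
  refine eventually_congr (Eventually.of_forall fun t => ?_)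
  constructor
  · intro h
    by_contra h'
    exact absurd h (not_lt.2 (mul_nonneg h2.le (not_lt.1 h')))
  · exact mul_neg_of_pos_of_neg h2

theorem isPositive_vec_of_sin_neg {θ c : ℝ} (h : sin θ < 0) : IsPositive T (F.vec θ c) := by
  rw [isPositive_iff]
  filter_upwards [eventually_gt_atTop (c / (-sin θ * F.r))] with t ht
  have := (div_lt_iff₀ (mul_pos (neg_pos.2 h) F.r_pos)).1 ht
  linarith

theorem not_isPositive_vec_of_sin_pos {θ c : ℝ} (h : 0 < sin θ) : ¬ IsPositive T (F.vec θ c) := by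
  rw [isPositive_iff]
  intro H
  obtain ⟨t, h₁, h₂⟩ := (H.and (eventually_gt_atTop (-c / (sin θ * F.r)))).exists
  have := (div_lt_iff₀ (mul_pos h F.r_pos)).1 h₂
  linarith

/-- The line is parallel to the belt line, on which the function is then constant. Among the seeds
this happens for the second vector when B = 0 and for the third when A = B. -/
theorem isPositive_vec_of_sin_eq_zero {θ c : ℝ} (h : sin θ = 0) :
    IsPositive T (F.vec θ c) ↔ c < 0 := by
  rw [isPositive_iff]
  simp only [h, zero_mul, zero_add, eventually_const]

theorem translateVector_vec (t θ c : ℝ) :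
    translateVector (t • F.e) (F.vec θ c) = F.vec θ (c - sin θ * t) := by
  simp only [translateVector, vec, inner_smul_right, F.inner_normal_e]
  congr 1
  ring

/-- The exchange matrix of a seed. -/
def stateMatrix (A B : ℝ) : Matrix (Fin 3) (Fin 3) ℝ :=
  -- For acute A and B the arrows 0 → 2 → 1 are always present. The sign of cos (A + B) decides
  -- between 1 → 0, which closes a cycle, and 0 → 1, which makes 0 the source and 1 the sink.
  !![0, -(2 * cos (A + B)), 2 * cos B;
     2 * cos (A + B), 0, -(2 * cos A);
     -(2 * cos B), 2 * cos A, 0]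

/-- The seed with angles `A` and `B` at position `p` on the belt line. -/
def state (A B p : ℝ) : LabelledSeed where
  v := ![F.vec (-A) (p * sin A),
    F.vec B (-(p * sin B) + F.K * cos (A + B) / sin A),
    F.vec (π + (B - A)) (p * sin (B - A) - F.K * cos B / sin A)]
  B := stateMatrix A B

theorem state_v_zero (A B p : ℝ) : (F.state A B p).v 0 = F.vec (-A) (p * sin A) := rfl

theorem state_v_one (A B p : ℝ) :
    (F.state A B p).v 1 = F.vec B (-(p * sin B) + F.K * cos (A + B) / sin A) := rfl

theorem state_v_two (A B p : ℝ) :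
    (F.state A B p).v 2 = F.vec (π + (B - A)) (p * sin (B - A) - F.K * cos B / sin A) := rfl

theorem translate_state (t A B p : ℝ) :
    (F.state A B p).translate (t • F.e) = F.state A B (p + t) := by
  have h : ∀ i, translateVector (t • F.e) ((F.state A B p).v i) = (F.state A B (p + t)).v i := by
    intro i
    fin_cases i
    · simp only [Fin.zero_eta, state_v_zero, translateVector_vec]
      refine F.vec_congr rfl rfl ?_
      rw [sin_neg]
      ring
    · simp only [Fin.mk_one, state_v_one, translateVector_vec]
      refine F.vec_congr rfl rfl ?_
      ring
    · simp only [Fin.reduceFinMk, state_v_two, translateVector_vec]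
      refine F.vec_congr rfl rfl ?_
      rw [add_comm π, sin_add_pi]
      ring
  simp only [LabelledSeed.translate, h]
  rfl

end BeltFrame

end

end AffineExchange

/-! ### The mutations of a seed in normal form. -/

namespace AffineExchange

open Real Filter

noncomputable section

variable {T : Affine.Triangle ℝ Plane}

namespace BeltFrame

set_option linter.unusedSimpArgs false

variable (F : BeltFrame T)

/-- Index 2 is the middle of the path 0 → 2 → 1, so the entry between 0 and 1 grows by 4 cos A cos
B, and the product formula turns -2 cos(A+B) into 2 cos(B-A). -/
theorem mutateMatrix_state {A B : ℝ} (hA : 0 < cos A) (hB : 0 < cos B) :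
    mutateMatrix (stateMatrix A B) 2 =
      !![0, 2 * cos (B - A), -(2 * cos B);
         -(2 * cos (B - A)), 0, 2 * cos A;
         2 * cos B, -(2 * cos A), 0] := by
  have h : cos (A + B) + cos (B - A) = 2 * cos A * cos B := by
    rw [cos_add, cos_sub]; ring
  have hA' : |2 * cos A| = 2 * cos A := abs_of_pos (by linarith)
  have hB' : |2 * cos B| = 2 * cos B := abs_of_pos (by linarith)
  ext i j
  fin_cases i <;> fin_cases j <;>
    simp [mutateMatrix, stateMatrix, hA', hB', abs_neg] <;>
    first | linear_combination 2 * h | linear_combination -2 * h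

/-- Mutation at the third vector, when it is positive. -/
theorem mutate_two_of_le {A B p : ℝ} (hA : 0 < A) (hAB : A ≤ B) (hB : B < π / 2) :
    (Quotient.mk _ ((F.state A B p).mutate T 2) : Seed) =
      Quotient.mk _ (F.state A (B - A) p) := by
  have hsA : 0 < sin A := sin_pos_of_pos_of_lt_pi hA (by linarith)
  have hcA : 0 < cos A := cos_pos_of_mem_Ioo ⟨by linarith, by linarith⟩
  have hcB : 0 < cos B := cos_pos_of_mem_Ioo ⟨by linarith, by linarith⟩
  have hpos : IsPositive T ((F.state A B p).v 2) := by
    rw [state_v_two]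
    rcases hAB.eq_or_lt with h | h
    · rw [isPositive_vec_of_sin_eq_zero _ (by simp [h]), ← h]
      have : 0 < F.K * cos A / sin A := div_pos (mul_pos F.K_pos hcA) hsA
      simpa using this
    · refine F.isPositive_vec_of_sin_neg ?_
      rw [add_comm, sin_add_pi]
      exact neg_neg_of_pos (sin_pos_of_pos_of_lt_pi (by linarith) (by linarith))
  have h0 : 0 < (F.state A B p).B 0 2 := by
    change 0 < 2 * cos B
    linarith
  have h1 : ¬ 0 < (F.state A B p).B 1 2 := by
    change ¬ 0 < -(2 * cos A)
    linarith
  -- The reversed vector 2 takes the place of vector 1, and the reflected vector 1 that of vector 2.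
  refine mk_eq_mk_of_perm (Equiv.swap 1 2) (fun i => ?_) fun i j => ?_
  · fin_cases i
    · exact (mutate_v_of_pos_of_lt hpos (by decide) h0).symm
    · refine Eq.trans ?_ (mutate_v_self _ _).symm
      change (F.state A (B - A) p).v 1 = _
      simp only [state_v_zero, state_v_one, state_v_two, neg_vec]
      refine F.vec_congr ?_ ?_ ?_
      · rw [add_comm π, sin_add_pi, sin_add_pi, neg_neg]
      · rw [add_comm π, cos_add_pi, cos_add_pi, neg_neg]
      · rw [add_sub_cancel]
        ring
    · refine Eq.trans ?_ (mutate_v_of_pos_of_not_lt hpos (by decide) h1).symm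
      change (F.state A (B - A) p).v 2 = _
      simp only [state_v_zero, state_v_one, state_v_two, vec_sub_form]
      obtain ⟨D, rfl⟩ : ∃ D, B = A + D := ⟨B - A, by ring⟩
      have e1 : 2 * (π + (A + D - A)) - (A + D) + π = (π + (A + D - A - A)) + 2 * π := by ring
      have e2 : A + D - (π + (A + D - A)) = A - π := by ring
      rw [e1, e2, cos_sub_pi]
      refine F.vec_congr (sin_add_two_pi _).symm (cos_add_two_pi _).symm ?_
      rw [show A + (A + D) = (A + D) + A by ring, cos_add (A + D) A, add_sub_cancel_left,
        sin_sub, sin_add, cos_add]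
      have := sin_sq_add_cos_sq A
      field_simp
      linear_combination F.K * cos D * this
  · rw [show ((F.state A B p).mutate T 2).B = mutateMatrix (stateMatrix A B) 2 from rfl,
      mutateMatrix_state hcA hcB]
    fin_cases i <;> fin_cases j <;>
      simp [state, stateMatrix, Equiv.swap_apply_def]

/-- Mutation at the third vector, when it is negative. -/
theorem mutate_two_of_lt {A B p : ℝ} (hB : 0 ≤ B) (hBA : B < A) (hA : A < π / 2) :
    (Quotient.mk _ ((F.state A B p).mutate T 2) : Seed) =
      Quotient.mk _ (F.state (A - B) B (p + F.K * (cos B / (sin A * sin (A - B))))) := by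
  have hsA : 0 < sin A := sin_pos_of_pos_of_lt_pi (by linarith) (by linarith)
  have hsD : 0 < sin (A - B) := sin_pos_of_pos_of_lt_pi (by linarith) (by linarith)
  have hcA : 0 < cos A := cos_pos_of_mem_Ioo ⟨by linarith, by linarith⟩
  have hcB : 0 < cos B := cos_pos_of_mem_Ioo ⟨by linarith, by linarith⟩
  have hneg : sin (B - A) = -sin (A - B) := by rw [← sin_neg, neg_sub]
  have hpos : ¬ IsPositive T ((F.state A B p).v 2) := by
    rw [state_v_two]
    refine F.not_isPositive_vec_of_sin_pos ?_
    rwa [add_comm, sin_add_pi, hneg, neg_neg]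
  have h0 : ¬ (F.state A B p).B 0 2 < 0 := by
    change ¬ 2 * cos B < 0
    linarith
  have h1 : (F.state A B p).B 1 2 < 0 := by
    change -(2 * cos A) < 0
    linarith
  refine mk_eq_mk_of_perm (Equiv.swap 0 2) (fun i => ?_) fun i j => ?_
  · fin_cases i
    · refine Eq.trans ?_ (mutate_v_self _ _).symm
      change (F.state (A - B) B _).v 0 = _
      simp only [state_v_zero, state_v_one, state_v_two, neg_vec]
      refine F.vec_congr ?_ ?_ ?_
      · rw [add_comm π, sin_add_pi, sin_add_pi, neg_neg, neg_sub]
      · rw [add_comm π, cos_add_pi, cos_add_pi, neg_neg, neg_sub]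
      · rw [hneg]
        field_simp
        ring
    · refine Eq.trans ?_ (mutate_v_of_not_pos_of_lt hpos (by decide) h1).symm
      change (F.state (A - B) B _).v 1 = _
      rw [state_v_one, state_v_one, sub_add_cancel]
      refine F.vec_congr rfl rfl ?_
      have e : cos A * sin A - sin B * cos B = cos (A + B) * sin (A - B) := by
        rw [cos_add, sin_sub]
        linear_combination (-(sin A * cos A)) * sin_sq_add_cos_sq B
          + sin B * cos B * sin_sq_add_cos_sq A
      field_simp
      linear_combination F.K * e
    · refine Eq.trans ?_ (mutate_v_of_not_pos_of_not_lt hpos (by decide) h0).symm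
      change (F.state (A - B) B _).v 2 = _
      simp only [state_v_zero, state_v_one, state_v_two, vec_sub_form]
      have e1 : 2 * (π + (B - A)) - -A + π = (π + (B - (A - B))) + 2 * π := by ring
      have e2 : -A - (π + (B - A)) = -(B + π) := by ring
      rw [e1, e2, cos_neg, cos_add_pi]
      refine F.vec_congr (sin_add_two_pi _).symm (cos_add_two_pi _).symm ?_
      obtain ⟨D, rfl⟩ : ∃ D, A = B + D := ⟨A - B, by ring⟩
      rw [add_sub_cancel_left] at hsD
      have e : sin (B - D) = sin (B + D) - 2 * cos B * sin D := by
        rw [sin_sub, sin_add]; ring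
      rw [add_sub_cancel_left, show B - (B + D) = -D by ring, sin_neg, e]
      field_simp
      ring
  · rw [show ((F.state A B p).mutate T 2).B = mutateMatrix (stateMatrix A B) 2 from rfl,
      mutateMatrix_state hcA hcB]
    fin_cases i <;> fin_cases j <;>
      simp [state, stateMatrix, Equiv.swap_apply_def]
    all_goals rw [← cos_neg, neg_sub]

/-- Mutation at the second vector of a seed with a cyclic quiver. -/
theorem mutate_one_of_cos_pos {A B p : ℝ} (hA : 0 < A) (hB : 0 ≤ B) (hAB : A + B < π / 2) :
    (Quotient.mk _ ((F.state A B p).mutate T 1) : Seed) =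
      Quotient.mk _ (F.state A (A + B) p) := by
  have hsA : 0 < sin A := sin_pos_of_pos_of_lt_pi (by linarith) (by linarith)
  have hcA : 0 < cos A := cos_pos_of_mem_Ioo ⟨by linarith, by linarith⟩
  have hcAB : 0 < cos (A + B) := cos_pos_of_mem_Ioo ⟨by linarith, by linarith⟩
  have hpos : ¬ IsPositive T ((F.state A B p).v 1) := by
    rw [state_v_one]
    rcases hB.eq_or_lt with h | h
    · rw [isPositive_vec_of_sin_eq_zero _ (by simp [← h]), ← h]
      have : 0 < F.K * cos A / sin A := div_pos (mul_pos F.K_pos hcA) hsA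
      simpa using this.le
    · exact F.not_isPositive_vec_of_sin_pos (sin_pos_of_pos_of_lt_pi (by linarith) (by linarith))
  have h0 : (F.state A B p).B 0 1 < 0 := by
    change -(2 * cos (A + B)) < 0
    linarith
  have h2 : ¬ (F.state A B p).B 2 1 < 0 := by
    change ¬ 2 * cos A < 0
    linarith
  refine mk_eq_mk_of_perm (Equiv.swap 1 2) (fun i => ?_) fun i j => ?_
  · fin_cases i
    · exact (mutate_v_of_not_pos_of_lt hpos (by decide) h0).symm
    · refine Eq.trans ?_ (mutate_v_of_not_pos_of_not_lt hpos (by decide) h2).symm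
      change (F.state A (A + B) p).v 1 = _
      simp only [state_v_zero, state_v_one, state_v_two, vec_sub_form]
      have e1 : 2 * B - (π + (B - A)) + π = A + B := by ring
      have e2 : π + (B - A) - B = -(A - π) := by ring
      rw [e1, e2, cos_neg, cos_sub_pi]
      refine F.vec_congr rfl rfl ?_
      rw [cos_add A (A + B), sin_sub, sin_add, cos_add]
      have := sin_sq_add_cos_sq A
      field_simp
      linear_combination (-F.K * cos B) * this
    · refine Eq.trans ?_ (mutate_v_self _ _).symm
      change (F.state A (A + B) p).v 2 = _
      simp only [state_v_zero, state_v_one, state_v_two, neg_vec]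
      rw [add_sub_cancel_left, add_comm π]
      refine F.vec_congr rfl rfl ?_
      ring
  · have hA' : |2 * cos A| = 2 * cos A := abs_of_pos (by linarith)
    have hAB' : |2 * cos (A + B)| = 2 * cos (A + B) := abs_of_pos (by linarith)
    have h : cos (A + (A + B)) = 2 * cos A * cos (A + B) - cos B := by
      have e := cos_sub (A + B) A
      rw [add_sub_cancel_left] at e
      rw [cos_add A (A + B), e]
      ring
    rw [show ((F.state A B p).mutate T 1).B = mutateMatrix (stateMatrix A B) 1 from rfl]
    fin_cases i <;> fin_cases j <;>
      simp [state, stateMatrix, mutateMatrix, Equiv.swap_apply_def, hA', hAB', h] <;> ring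

/-- The first vector of a seed is positive. -/
theorem isPositive_state_v_zero {A B p : ℝ} (hA : 0 < A) (hA' : A < π) :
    IsPositive T ((F.state A B p).v 0) := by
  rw [state_v_zero]
  refine F.isPositive_vec_of_sin_neg ?_
  rw [sin_neg]
  exact neg_neg_of_pos (sin_pos_of_pos_of_lt_pi hA hA')

/-- Mutation at the first vector of a seed with a cyclic quiver. -/
theorem mutate_zero_of_cos_pos {A B p : ℝ} (hA : 0 < A) (hB : 0 ≤ B) (hAB : A + B < π / 2) :
    (Quotient.mk _ ((F.state A B p).mutate T 0) : Seed) =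
      Quotient.mk _ (F.state (A + B) B (p - F.K * (cos B / (sin A * sin (A + B))))) := by
  have hsA : 0 < sin A := sin_pos_of_pos_of_lt_pi (by linarith) (by linarith)
  have hsAB : 0 < sin (A + B) := sin_pos_of_pos_of_lt_pi (by linarith) (by linarith)
  have hcB : 0 < cos B := cos_pos_of_mem_Ioo ⟨by linarith, by linarith⟩
  have hcAB : 0 < cos (A + B) := cos_pos_of_mem_Ioo ⟨by linarith, by linarith⟩
  have hpos := F.isPositive_state_v_zero (B := B) (p := p) hA (by linarith)
  have h1 : 0 < (F.state A B p).B 1 0 := by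
    change 0 < 2 * cos (A + B)
    linarith
  have h2 : ¬ 0 < (F.state A B p).B 2 0 := by
    change ¬ 0 < -(2 * cos B)
    linarith
  refine mk_eq_mk_of_perm (Equiv.swap 0 2) (fun i => ?_) fun i j => ?_
  · fin_cases i
    · refine Eq.trans ?_ (mutate_v_of_pos_of_not_lt hpos (by decide) h2).symm
      change (F.state (A + B) B _).v 0 = _
      simp only [state_v_zero, state_v_one, state_v_two, vec_sub_form]
      have e1 : 2 * -A - (π + (B - A)) + π = -(A + B) := by ring
      have e2 : π + (B - A) - -A = B + π := by ring
      rw [e1, e2, cos_add_pi]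
      refine F.vec_congr rfl rfl ?_
      have e : sin (B - A) + 2 * cos B * sin A = sin (A + B) := by
        rw [sin_sub, sin_add]; ring
      field_simp
      linear_combination (-p * sin A) * e
    · refine Eq.trans ?_ (mutate_v_of_pos_of_lt hpos (by decide) h1).symm
      change (F.state (A + B) B _).v 1 = _
      rw [state_v_one, state_v_one]
      refine F.vec_congr rfl rfl ?_
      have e : sin B * cos B + cos (A + B + B) * sin A = cos (A + B) * sin (A + B) := by
        have e3 := sin_sub (A + B) B
        rw [add_sub_cancel_right] at e3
        rw [cos_add (A + B) B, e3]
        linear_combination (sin (A + B) * cos (A + B)) * sin_sq_add_cos_sq B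
          - sin B * cos B * sin_sq_add_cos_sq (A + B)
      field_simp
      linear_combination F.K * e
    · refine Eq.trans ?_ (mutate_v_self _ _).symm
      change (F.state (A + B) B _).v 2 = _
      simp only [state_v_zero, state_v_one, state_v_two, neg_vec]
      have e1 : π + (B - (A + B)) = -A + π := by ring
      have e2 : B - (A + B) = -A := by ring
      rw [e1, e2, sin_neg]
      refine F.vec_congr rfl rfl ?_
      field_simp
      ring
  · have hB' : |2 * cos B| = 2 * cos B := abs_of_pos (by linarith)
    have hAB' : |2 * cos (A + B)| = 2 * cos (A + B) := abs_of_pos (by linarith)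
    have h : cos (A + B + B) = 2 * cos B * cos (A + B) - cos A := by
      have e := cos_sub (A + B) B
      rw [add_sub_cancel_right] at e
      rw [cos_add (A + B) B, e]
      ring
    rw [show ((F.state A B p).mutate T 0).B = mutateMatrix (stateMatrix A B) 0 from rfl]
    fin_cases i <;> fin_cases j <;>
      simp [state, stateMatrix, mutateMatrix, Equiv.swap_apply_def, hB', hAB', h] <;> ring

/-- Mutation at the source of a seed with an acyclic quiver. -/
theorem mutate_zero_of_cos_neg {A B p : ℝ} (hA : A < π / 2) (hB : B < π / 2)
    (hAB : π / 2 < A + B) :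
    (Quotient.mk _ ((F.state A B p).mutate T 0) : Seed) =
      Quotient.mk _ (F.flip.state (π - (A + B)) A (p - F.K * (cos B / (sin A * sin (A + B))))) := by
  have hsA : 0 < sin A := sin_pos_of_pos_of_lt_pi (by linarith) (by linarith)
  have hsAB : 0 < sin (A + B) := sin_pos_of_pos_of_lt_pi (by linarith) (by linarith)
  have hcB : 0 < cos B := cos_pos_of_mem_Ioo ⟨by linarith, by linarith⟩
  have hcAB : cos (A + B) < 0 := cos_neg_of_pi_div_two_lt_of_lt hAB (by linarith)
  have hpos := F.isPositive_state_v_zero (A := A) (B := B) (p := p) (by linarith) (by linarith)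
  have h1 : ¬ 0 < (F.state A B p).B 1 0 := by
    change ¬ 0 < 2 * cos (A + B)
    linarith
  have h2 : ¬ 0 < (F.state A B p).B 2 0 := by
    change ¬ 0 < -(2 * cos B)
    linarith
  have hK : F.flip.K = F.K := rfl
  -- A cyclic renumbering: the reversed source becomes the sink 1, the middle vertex the source 0,
  -- and the old sink the middle vertex 2.
  refine mk_eq_mk_of_perm (Equiv.swap 0 1 * Equiv.swap 0 2) (fun i => ?_) fun i j => ?_
  · fin_cases i
    · refine Eq.trans ?_ (mutate_v_of_pos_of_not_lt hpos (by decide) h2).symm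
      change (F.flip.state (π - (A + B)) A _).v 0 = _
      simp only [state_v_zero, state_v_one, state_v_two, vec_sub_form]
      rw [flip_vec]
      have e1 : 2 * -A - (π + (B - A)) + π = π - -(π - (A + B)) - 2 * π := by ring
      have e2 : π + (B - A) - -A = B + π := by ring
      rw [e1, e2, cos_add_pi, sin_pi_sub (A + B)]
      refine F.vec_congr (sin_sub_two_pi _).symm (cos_sub_two_pi _).symm ?_
      have e : sin (B - A) + 2 * cos B * sin A = sin (A + B) := by
        rw [sin_sub, sin_add]; ring
      field_simp
      linear_combination (-p * sin A) * e
    · refine Eq.trans ?_ (mutate_v_self _ _).symm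
      change (F.flip.state (π - (A + B)) A _).v 1 = _
      simp only [state_v_zero, state_v_one, state_v_two, neg_vec]
      rw [flip_vec, hK, sin_pi_sub, show -A + π = π - A by ring]
      refine F.vec_congr rfl rfl ?_
      have e1 : π - (A + B) + A = π - B := by ring
      rw [e1, cos_pi_sub]
      field_simp
      ring
    · refine Eq.trans ?_ (mutate_v_of_pos_of_not_lt hpos (by decide) h1).symm
      change (F.flip.state (π - (A + B)) A _).v 2 = _
      simp only [state_v_zero, state_v_one, state_v_two, vec_sub_form]
      rw [flip_vec, hK, sin_pi_sub]
      have e1 : 2 * -A - B + π = π - (π + (A - (π - (A + B)))) := by ring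
      have e2 : B - -A = A + B := by ring
      have e3 : A - (π - (A + B)) = A + (A + B) - π := by ring
      rw [e1, e2, e3, sin_sub_pi]
      refine F.vec_congr rfl rfl ?_
      have e4 : sin (A + (A + B)) = sin B + 2 * cos (A + B) * sin A := by
        have h := sin_sub (A + B) A
        rw [add_sub_cancel_left] at h
        rw [sin_add A (A + B), h]
        ring
      have e5 : cos B * sin (A + (A + B)) - cos A * sin A = cos (A + B) * sin (A + B) := by
        have h := cos_sub (A + B) A
        rw [add_sub_cancel_left] at h
        rw [sin_add A (A + B), h]
        linear_combination (sin A * cos A) * sin_sq_add_cos_sq (A + B)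
          + sin (A + B) * cos (A + B) * sin_sq_add_cos_sq A
      field_simp
      linear_combination F.K * e5 - p * sin A * sin (A + B) * e4
  · have hB' : |2 * cos B| = 2 * cos B := abs_of_pos (by linarith)
    have hAB' : |2 * cos (A + B)| = -(2 * cos (A + B)) := abs_of_neg (by linarith)
    have h : cos (π - (A + B) + A) = -cos B := by
      rw [show π - (A + B) + A = π - B by ring, cos_pi_sub]
    rw [show ((F.state A B p).mutate T 0).B = mutateMatrix (stateMatrix A B) 0 from rfl]
    fin_cases i <;> fin_cases j <;>
      simp [state, stateMatrix, mutateMatrix, hB', hAB', h, Equiv.swap_apply_def]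

/-- Mutation at the sink of a seed with an acyclic quiver. -/
theorem mutate_one_of_cos_neg {A B p : ℝ} (hA : A < π / 2) (hB : B < π / 2)
    (hAB : π / 2 < A + B) :
    (Quotient.mk _ ((F.state A B p).mutate T 1) : Seed) =
      Quotient.mk _ (F.flip.state B (π - (A + B)) (p - F.K * (cos (A + B) / (sin A * sin B)))) := by
  have hsA : 0 < sin A := sin_pos_of_pos_of_lt_pi (by linarith) (by linarith)
  have hsB : 0 < sin B := sin_pos_of_pos_of_lt_pi (by linarith) (by linarith)
  have hcA : 0 < cos A := cos_pos_of_mem_Ioo ⟨by linarith, by linarith⟩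
  have hcAB : cos (A + B) < 0 := cos_neg_of_pi_div_two_lt_of_lt hAB (by linarith)
  have hpos : ¬ IsPositive T ((F.state A B p).v 1) := F.not_isPositive_vec_of_sin_pos hsB
  have h0 : ¬ (F.state A B p).B 0 1 < 0 := by
    change ¬ -(2 * cos (A + B)) < 0
    linarith
  have h2 : ¬ (F.state A B p).B 2 1 < 0 := by
    change ¬ 2 * cos A < 0
    linarith
  have hK : F.flip.K = F.K := rfl
  -- The inverse rotation: the reversed sink becomes the source 0, the middle vertex the sink 1, and
  -- the old source the middle vertex 2.
  refine mk_eq_mk_of_perm (Equiv.swap 0 1 * Equiv.swap 1 2) (fun i => ?_) fun i j => ?_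
  · fin_cases i
    · refine Eq.trans ?_ (mutate_v_self _ _).symm
      change (F.flip.state B (π - (A + B)) _).v 0 = _
      simp only [state_v_zero, state_v_one, state_v_two, neg_vec]
      rw [flip_vec]
      rw [show π - -B = B + π by ring]
      refine F.vec_congr rfl rfl ?_
      field_simp
      ring
    · refine Eq.trans ?_ (mutate_v_of_not_pos_of_not_lt hpos (by decide) h2).symm
      change (F.flip.state B (π - (A + B)) _).v 1 = _
      simp only [state_v_zero, state_v_one, state_v_two, vec_sub_form]
      rw [flip_vec, hK, sin_pi_sub]
      have e1 : 2 * B - (π + (B - A)) + π = π - (π - (A + B)) := by ring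
      have e2 : π + (B - A) - B = -(A - π) := by ring
      have e3 : B + (π - (A + B)) = π - A := by ring
      rw [e1, e2, e3, cos_neg, cos_sub_pi, cos_pi_sub]
      refine F.vec_congr rfl rfl ?_
      have e4 : sin (B - A) - 2 * cos A * sin B = -sin (A + B) := by
        rw [sin_sub, sin_add]; ring
      have e5 : cos A * sin A - sin B * cos B = cos (A + B) * (sin (A + B) - 2 * cos A * sin B) := by
        rw [cos_add, sin_add]
        linear_combination (-(sin A * cos A)) * sin_sq_add_cos_sq B
          + sin B * cos B * sin_sq_add_cos_sq A
      field_simp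
      linear_combination -F.K * e5 - p * sin A * sin B * e4
    · refine Eq.trans ?_ (mutate_v_of_not_pos_of_not_lt hpos (by decide) h0).symm
      change (F.flip.state B (π - (A + B)) _).v 2 = _
      simp only [state_v_zero, state_v_one, state_v_two, vec_sub_form]
      rw [flip_vec, hK]
      have e1 : 2 * B - -A + π = π - (π + (π - (A + B) - B)) + 2 * π := by ring
      have e2 : -A - B = -(A + B) := by ring
      have e3 : π - (A + B) - B = π - (A + B + B) := by ring
      rw [e1, e2, e3, cos_neg, sin_pi_sub, cos_pi_sub]
      refine F.vec_congr (sin_add_two_pi _).symm (cos_add_two_pi _).symm ?_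
      have e4 : sin (A + B + B) = sin A + 2 * cos (A + B) * sin B := by
        have h := sin_sub (A + B) B
        rw [add_sub_cancel_right] at h
        rw [sin_add (A + B) B, h]
        ring
      rw [e4]
      field_simp
      ring
  · have hA' : |2 * cos A| = 2 * cos A := abs_of_pos (by linarith)
    have hAB' : |2 * cos (A + B)| = -(2 * cos (A + B)) := abs_of_neg (by linarith)
    have h : cos (B + (π - (A + B))) = -cos A := by
      rw [show B + (π - (A + B)) = π - A by ring, cos_pi_sub]
    rw [show ((F.state A B p).mutate T 1).B = mutateMatrix (stateMatrix A B) 1 from rfl]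
    fin_cases i <;> fin_cases j <;>
      simp [state, stateMatrix, mutateMatrix, hA', hAB', h, Equiv.swap_apply_def]

end BeltFrame

end

end AffineExchange

/-! ### The combinatorial model: integer angles and a real position. -/

namespace AffineExchange

open Real Filter

noncomputable section

variable {T : Affine.Triangle ℝ Plane}

/-- Parameters of a seed: an orientation, the two angles as multiples of `π / (2 n + 1)`, and the
position on the belt line. -/
@[ext]
structure SeedParam where
  /-- the orientation -/
  ε : Bool
  /-- the first angle -/
  a : ℕ
  /-- the second angle -/
  b : ℕ
  /-- the position on the belt line -/
  p : ℝ

/-- The unit of angles. -/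
def unitAngle (n : ℕ) : ℝ := π / (2 * n + 1)

theorem unitAngle_pos (n : ℕ) : 0 < unitAngle n := by
  unfold unitAngle; positivity

theorem two_mul_add_one_mul_unitAngle (n : ℕ) : (2 * n + 1) * unitAngle n = π := by
  unfold unitAngle; field_simp

/-- As 2n + 1 is odd, no multiple of the unit angle is π/2: `a ≤ n` and `n + 1 ≤ a` separate the two
sides strictly, and no arrow of a seed has weight 0. -/
theorem mul_unitAngle_lt {n a : ℕ} (h : a ≤ n) : a * unitAngle n < π / 2 := by
  have h₁ : (a : ℝ) ≤ n := by exact_mod_cast h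
  have := mul_le_mul_of_nonneg_right h₁ (unitAngle_pos n).le
  have := two_mul_add_one_mul_unitAngle n
  have := unitAngle_pos n
  linarith

theorem lt_mul_unitAngle {n a : ℕ} (h : n + 1 ≤ a) : π / 2 < a * unitAngle n := by
  have h₁ : (n : ℝ) + 1 ≤ a := by exact_mod_cast h
  have := mul_le_mul_of_nonneg_right h₁ (unitAngle_pos n).le
  have := two_mul_add_one_mul_unitAngle n
  have := unitAngle_pos n
  linarith

theorem sub_mul_unitAngle {n k : ℕ} (h : k ≤ 2 * n + 1) :
    ((2 * n + 1 - k : ℕ) : ℝ) * unitAngle n = π - k * unitAngle n := by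
  rw [Nat.cast_sub h, ← two_mul_add_one_mul_unitAngle n]
  push_cast
  ring

/-- The distance, in units of length, by which the position changes under a mutation. -/
def increment (n a b : ℕ) : ℝ :=
  cos (b * unitAngle n) / (sin (a * unitAngle n) * sin (a * unitAngle n + b * unitAngle n))

/-- Half of the mutations, in terms of the parameters; the other mutations are their inverses. -/
inductive Move (n : ℕ) (K : ℝ) : SeedParam → SeedParam → Prop
  -- The first two moves start at cyclic quivers (mutation at 1 and at 0, each undone at 2), the
  -- third at acyclic ones (mutation at the source 0, undone at the sink 1).
  | up (ε : Bool) (a b : ℕ) (p : ℝ) : 1 ≤ a → a + b ≤ n → Move n K ⟨ε, a, b, p⟩ ⟨ε, a, a + b, p⟩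
  | right (ε : Bool) (a b : ℕ) (p : ℝ) : 1 ≤ a → a + b ≤ n →
      Move n K ⟨ε, a, b, p⟩ ⟨ε, a + b, b, p - K * increment n a b⟩
  | turn (ε : Bool) (a b : ℕ) (p : ℝ) : a ≤ n → b ≤ n → n + 1 ≤ a + b →
      Move n K ⟨ε, a, b, p⟩ ⟨!ε, 2 * n + 1 - (a + b), a, p - K * increment n a b⟩

/-- The mutations in terms of the parameters. -/
def Step (n : ℕ) (K : ℝ) (s t : SeedParam) : Prop := Move n K s t ∨ Move n K t s

theorem Step.symm {n : ℕ} {K : ℝ} {s t : SeedParam} (h : Step n K s t) : Step n K t s := Or.symm h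

/-- The parameters that occur. -/
def SeedParam.Valid (n : ℕ) (s : SeedParam) : Prop := 1 ≤ s.a ∧ s.a ≤ n ∧ s.b ≤ n

theorem Move.valid {n : ℕ} {K : ℝ} {s t : SeedParam} (h : Move n K s t) :
    s.Valid n ∧ t.Valid n := by
  cases h <;> simp only [SeedParam.Valid] <;> omega

theorem Step.valid {n : ℕ} {K : ℝ} {s t : SeedParam} (h : Step n K s t) : t.Valid n :=
  h.elim (fun h => h.valid.2) fun h => h.valid.1

namespace BeltFrame

variable (F : BeltFrame T)

/-- The frame or its mirror image. -/
def orient : Bool → BeltFrame T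
  | true => F
  | false => F.flip

theorem orient_not (ε : Bool) : F.orient (!ε) = (F.orient ε).flip := by
  cases ε
  · exact F.flip_flip.symm
  · rfl

theorem orient_K (ε : Bool) : (F.orient ε).K = F.K := by cases ε <;> rfl

theorem orient_e (ε : Bool) : (F.orient ε).e = F.e := by cases ε <;> rfl

/-- The labelled seed with given parameters. -/
def labelledSeedOf (n : ℕ) (s : SeedParam) : LabelledSeed :=
  (F.orient s.ε).state (s.a * unitAngle n) (s.b * unitAngle n) s.p

/-- The seed with given parameters. -/
def seedOf (n : ℕ) (s : SeedParam) : Seed := Quotient.mk _ (F.labelledSeedOf n s)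

theorem mutate_of_up {n a b : ℕ} (ε : Bool) (p : ℝ) (ha : 1 ≤ a) (hab : a + b ≤ n) :
    Quotient.mk _ ((F.labelledSeedOf n ⟨ε, a, b, p⟩).mutate T 1) =
        F.seedOf n ⟨ε, a, a + b, p⟩ ∧
      Quotient.mk _ ((F.labelledSeedOf n ⟨ε, a, a + b, p⟩).mutate T 2) =
        F.seedOf n ⟨ε, a, b, p⟩ := by
  have h0 : 0 < (a : ℝ) * unitAngle n := mul_pos (by exact_mod_cast ha) (unitAngle_pos n)
  have h1 : 0 ≤ (b : ℝ) * unitAngle n := mul_nonneg (by positivity) (unitAngle_pos n).le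
  have h2 := mul_unitAngle_lt hab
  have e : ((a + b : ℕ) : ℝ) * unitAngle n = a * unitAngle n + b * unitAngle n := by
    push_cast; ring
  simp only [seedOf, labelledSeedOf]
  rw [e] at h2 ⊢
  constructor
  · exact mutate_one_of_cos_pos _ h0 h1 h2
  · rw [mutate_two_of_le _ h0 (by linarith) h2, add_sub_cancel_left]

theorem mutate_of_right {n a b : ℕ} (ε : Bool) (p : ℝ) (ha : 1 ≤ a) (hab : a + b ≤ n) :
    Quotient.mk _ ((F.labelledSeedOf n ⟨ε, a, b, p⟩).mutate T 0) =
        F.seedOf n ⟨ε, a + b, b, p - F.K * increment n a b⟩ ∧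
      Quotient.mk _ ((F.labelledSeedOf n
        ⟨ε, a + b, b, p - F.K * increment n a b⟩).mutate T 2) = F.seedOf n ⟨ε, a, b, p⟩ := by
  have h0 : 0 < (a : ℝ) * unitAngle n := mul_pos (by exact_mod_cast ha) (unitAngle_pos n)
  have h1 : 0 ≤ (b : ℝ) * unitAngle n := mul_nonneg (by positivity) (unitAngle_pos n).le
  have h2 := mul_unitAngle_lt hab
  have e : ((a + b : ℕ) : ℝ) * unitAngle n = a * unitAngle n + b * unitAngle n := by
    push_cast; ring
  simp only [seedOf, labelledSeedOf]
  rw [e] at h2 ⊢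
  constructor
  · rw [mutate_zero_of_cos_pos _ h0 h1 h2, orient_K]
    rfl
  · rw [mutate_two_of_lt _ h1 (by linarith) h2, add_sub_cancel_right, orient_K, increment]
    congr 2
    ring

theorem mutate_of_turn {n a b : ℕ} (ε : Bool) (p : ℝ) (ha : a ≤ n) (hb : b ≤ n)
    (hab : n + 1 ≤ a + b) :
    Quotient.mk _ ((F.labelledSeedOf n ⟨ε, a, b, p⟩).mutate T 0) =
        F.seedOf n ⟨!ε, 2 * n + 1 - (a + b), a, p - F.K * increment n a b⟩ ∧
      Quotient.mk _ ((F.labelledSeedOf n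
        ⟨!ε, 2 * n + 1 - (a + b), a, p - F.K * increment n a b⟩).mutate T 1) =
        F.seedOf n ⟨ε, a, b, p⟩ := by
  have h0 := mul_unitAngle_lt ha
  have h1 := mul_unitAngle_lt hb
  have h2 := lt_mul_unitAngle hab
  have e : ((a + b : ℕ) : ℝ) * unitAngle n = a * unitAngle n + b * unitAngle n := by
    push_cast; ring
  have e' := sub_mul_unitAngle (n := n) (k := a + b) (by omega)
  simp only [seedOf, labelledSeedOf]
  rw [e] at h2 e'
  rw [e', orient_not]
  constructor
  · rw [mutate_zero_of_cos_neg _ h0 h1 h2, orient_K]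
    rfl
  · rw [mutate_one_of_cos_neg _ (by linarith) h0 (by linarith), flip_flip]
    have e₁ : π - (a * unitAngle n + b * unitAngle n) + a * unitAngle n = π - b * unitAngle n := by
      ring
    rw [e₁, sub_sub_cancel, cos_pi_sub, sin_pi_sub, show (F.orient ε).flip.K = F.K from F.orient_K ε,
      increment]
    congr 2
    ring

theorem isMutation_of_move {n : ℕ} {s t : SeedParam} (h : Move n F.K s t) :
    IsMutation T (F.seedOf n s) (F.seedOf n t) ∧ IsMutation T (F.seedOf n t) (F.seedOf n s) := by
  cases h with
  | up ε a b p ha hab =>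
    have h := F.mutate_of_up ε p ha hab
    exact ⟨⟨_, 1, rfl, h.1.symm⟩, ⟨_, 2, rfl, h.2.symm⟩⟩
  | right ε a b p ha hab =>
    have h := F.mutate_of_right ε p ha hab
    exact ⟨⟨_, 0, rfl, h.1.symm⟩, ⟨_, 2, rfl, h.2.symm⟩⟩
  | turn ε a b p ha hb hab =>
    have h := F.mutate_of_turn ε p ha hb hab
    exact ⟨⟨_, 0, rfl, h.1.symm⟩, ⟨_, 1, rfl, h.2.symm⟩⟩

/-- The mutations of the seeds are those described by the parameters. -/
theorem isMutation_seedOf_iff {n : ℕ} {s : SeedParam} (hs : s.Valid n) (y : Seed) :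
    IsMutation T (F.seedOf n s) y ↔ ∃ t, Step n F.K s t ∧ y = F.seedOf n t := by
  constructor
  · intro h
    obtain ⟨k, rfl⟩ := (isMutation_mk_iff _ _).1 h
    obtain ⟨ε, a, b, p⟩ := s
    obtain ⟨h1, h2, h3⟩ := hs
    simp only at h1 h2 h3
    fin_cases k
    · by_cases hab : a + b ≤ n
      · exact ⟨_, Or.inl (Move.right ε a b p h1 hab), (F.mutate_of_right ε p h1 hab).1⟩
      · exact ⟨_, Or.inl (Move.turn ε a b p h2 h3 (by omega)),
          (F.mutate_of_turn ε p h2 h3 (by omega)).1⟩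
    · by_cases hab : a + b ≤ n
      · exact ⟨_, Or.inl (Move.up ε a b p h1 hab), (F.mutate_of_up ε p h1 hab).1⟩
      -- Mutation at the sink undoes a turn: the seed sought has the angles b and 2n + 1 - (a + b),
      -- and its position is advanced so that turning it ends at p.
      · have e₁ : 2 * n + 1 - (b + (2 * n + 1 - (a + b))) = a := by omega
        have key := Move.turn (K := F.K) (!ε) b (2 * n + 1 - (a + b))
          (p + F.K * increment n b (2 * n + 1 - (a + b))) h3 (by omega) (by omega)
        have key' := (F.mutate_of_turn (a := b) (b := 2 * n + 1 - (a + b)) (!ε)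
          (p + F.K * increment n b (2 * n + 1 - (a + b))) h3 (by omega) (by omega)).2
        rw [e₁, Bool.not_not, add_sub_cancel_right] at key key'
        exact ⟨_, Or.inr key, key'⟩
    · by_cases hab : a ≤ b
      · obtain ⟨d, rfl⟩ : ∃ d, b = a + d := ⟨b - a, by omega⟩
        exact ⟨_, Or.inr (Move.up ε a d p h1 h3), (F.mutate_of_up ε p h1 h3).2⟩
      -- The case b = 0 is included; then d = a, and the mutation is a pure translation.
      · obtain ⟨d, rfl⟩ : ∃ d, a = d + b := ⟨a - b, by omega⟩
        have key := Move.right (K := F.K) ε d b (p + F.K * increment n d b) (by omega) h2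
        have key' := (F.mutate_of_right (a := d) (b := b) ε (p + F.K * increment n d b)
          (by omega) h2).2
        rw [add_sub_cancel_right] at key key'
        exact ⟨_, Or.inr key, key'⟩
  · rintro ⟨t, h | h, rfl⟩
    · exact (F.isMutation_of_move h).1
    · exact (F.isMutation_of_move h).2

/-- The seeds that can be reached from a given one. -/
theorem reflTransGen_isMutation_iff {n : ℕ} {s : SeedParam} (hs : s.Valid n) (y : Seed) :
    Relation.ReflTransGen (IsMutation T) (F.seedOf n s) y ↔
      ∃ t, t.Valid n ∧ Relation.ReflTransGen (Step n F.K) s t ∧ y = F.seedOf n t := by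
  constructor
  · intro h
    induction h with
    | refl => exact ⟨s, hs, Relation.ReflTransGen.refl, rfl⟩
    | tail _ hyz ih =>
      obtain ⟨t, ht, hst, rfl⟩ := ih
      obtain ⟨u, hu, rfl⟩ := (F.isMutation_seedOf_iff ht _).1 hyz
      exact ⟨u, hu.valid, hst.tail hu, rfl⟩
  · rintro ⟨t, ht, hst, rfl⟩
    clear ht
    induction hst with
    | refl => exact Relation.ReflTransGen.refl
    | tail _ h ih =>
      exact ih.tail ((F.isMutation_seedOf_iff (Step.valid h.symm) _).2 ⟨_, h, rfl⟩)

end BeltFrame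

/-! ### Translations of seeds and uniqueness of the parameters. -/

/-- Translation along the belt line, in terms of the parameters. -/
def SeedParam.shift (u : ℝ) (s : SeedParam) : SeedParam := ⟨s.ε, s.a, s.b, s.p + u⟩

theorem Move.shift {n : ℕ} {K : ℝ} {s t : SeedParam} (u : ℝ) (h : Move n K s t) :
    Move n K (s.shift u) (t.shift u) := by
  cases h with
  | up ε a b p ha hab => exact Move.up ε a b (p + u) ha hab
  | right ε a b p ha hab =>
    have := Move.right (K := K) ε a b (p + u) ha hab
    rwa [add_sub_right_comm] at this
  | turn ε a b p ha hb hab =>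
    have := Move.turn (K := K) ε a b (p + u) ha hb hab
    rwa [add_sub_right_comm] at this

theorem Step.shift {n : ℕ} {K : ℝ} {s t : SeedParam} (u : ℝ) (h : Step n K s t) :
    Step n K (s.shift u) (t.shift u) :=
  h.imp (Move.shift u) (Move.shift u)

theorem reflTransGen_step_shift {n : ℕ} {K : ℝ} {s t : SeedParam} (u : ℝ)
    (h : Relation.ReflTransGen (Step n K) s t) :
    Relation.ReflTransGen (Step n K) (s.shift u) (t.shift u) := by
  induction h with
  | refl => exact Relation.ReflTransGen.refl
  | tail _ h ih => exact ih.tail (h.shift u)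

theorem reflTransGen_step_symm {n : ℕ} {K : ℝ} {s t : SeedParam}
    (h : Relation.ReflTransGen (Step n K) s t) : Relation.ReflTransGen (Step n K) t s := by
  induction h with
  | refl => exact Relation.ReflTransGen.refl
  | tail _ h ih => exact ih.head h.symm

namespace BeltFrame

variable (F : BeltFrame T)

theorem translate_seedOf (n : ℕ) (u : ℝ) (s : SeedParam) :
    translate (u • F.e) (F.seedOf n s) = F.seedOf n (s.shift u) := by
  change Quotient.mk _ ((F.labelledSeedOf n s).translate (u • F.e)) = _
  have := (F.orient s.ε).translate_state u (s.a * unitAngle n) (s.b * unitAngle n) s.p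
  rw [orient_e] at this
  rw [labelledSeedOf, this]
  rfl

theorem eq_zero_of_inner_eq_zero {d : Plane} (he : inner ℝ d F.e = (0 : ℝ))
    (hf : inner ℝ d F.f = (0 : ℝ)) : d = 0 := by
  have ho : Orthonormal ℝ ![F.e, F.f] := by
    rw [orthonormal_iff_ite]
    intro i j
    fin_cases i <;> fin_cases j
    · simpa using F.inner_e_e
    · simpa using F.inner_e_f
    · simpa using F.inner_f_e
    · simpa using F.inner_f_f
  have hs := ho.linearIndependent.span_eq_top_of_card_eq_finrank (by simp)
  have hd : d ∈ Submodule.span ℝ (Set.range ![F.e, F.f]) := hs ▸ Submodule.mem_top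
  have key : ∀ x ∈ Submodule.span ℝ (Set.range ![F.e, F.f]), inner ℝ d x = (0 : ℝ) := by
    intro x hx
    induction hx using Submodule.span_induction with
    | mem x hx =>
      obtain ⟨i, rfl⟩ := hx
      fin_cases i
      · exact he
      · exact hf
    | zero => simp
    | add x y _ _ hx hy => rw [inner_add_right, hx, hy, add_zero]
    | smul c x _ hx => rw [inner_smul_right, hx, mul_zero]
  exact inner_self_eq_zero.1 (key d hd)

/-- The determinant of the two normals is sin (A + B) up to a nonzero factor, so they span the
plane. -/
theorem eq_zero_of_inner_normal_eq_zero {d : Plane} {A B : ℝ} (hAB : sin (A + B) ≠ 0)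
    (hA : inner ℝ (F.normal (-A)) d = (0 : ℝ)) (hB : inner ℝ (F.normal B) d = (0 : ℝ)) :
    d = 0 := by
  have h2 : √2 ≠ (0 : ℝ) := by positivity
  simp only [normal, inner_smul_left, inner_sub_left, sin_neg, cos_neg] at hA hB
  have hA' := (mul_eq_zero.1 hA).resolve_left (by simp)
  have hB' := (mul_eq_zero.1 hB).resolve_left (by simp)
  simp only [conj_trivial] at hA' hB'
  rw [sin_add] at hAB
  refine F.eq_zero_of_inner_eq_zero ?_ ?_
  · rw [real_inner_comm]
    refine (mul_eq_zero.1 (?_ : (sin A * cos B + cos A * sin B) * _ = 0)).resolve_left hAB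
    linear_combination (-cos B) * hA' + cos A * hB'
  · rw [real_inner_comm]
    refine (mul_eq_zero.1 (?_ : (sin A * cos B + cos A * sin B) * _ = 0)).resolve_left hAB
    linear_combination (-sin B) * hA' - sin A * hB'

/-- The directions of the three vectors of a seed as multiples of the unit angle. -/
def direction (n : ℕ) (s : SeedParam) : Fin 3 → ℤ :=
  match s.ε with
  | true => ![-s.a, s.b, 2 * n + 1 + (s.b - s.a)]
  | false => ![2 * n + 1 + s.a, 2 * n + 1 - s.b, s.a - s.b]

/-- Two directions in this window differ by at most 4n + 1, less than the full turn of 4n + 2 units,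
so equal normals force equal integers. -/
theorem direction_bounds {n : ℕ} {s : SeedParam} (hs : s.Valid n) (i : Fin 3) :
    -n ≤ direction n s i ∧ direction n s i ≤ 3 * n + 1 := by
  obtain ⟨ε, a, b, p⟩ := s
  obtain ⟨h₁, h₂, h₃⟩ := hs
  simp only at h₁ h₂ h₃
  cases ε <;> fin_cases i <;> simp [direction] <;> omega

theorem labelledSeedOf_v_fst (n : ℕ) (s : SeedParam) (i : Fin 3) :
    ((F.labelledSeedOf n s).v i).1 = F.normal (direction n s i * unitAngle n) := by
  have hflip : ∀ θ, F.flip.normal θ = F.normal (π - θ) := fun θ =>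
    congrArg Prod.fst (F.flip_vec θ 0)
  obtain ⟨ε, a, b, p⟩ := s
  have hN := two_mul_add_one_mul_unitAngle n
  cases ε
  · fin_cases i
    · change F.flip.normal (-(a * unitAngle n)) = F.normal (((2 * n + 1 + a : ℤ) : ℝ) * _)
      rw [hflip, ← hN]
      congr 1
      push_cast
      ring
    · change F.flip.normal (b * unitAngle n) = F.normal (((2 * n + 1 - b : ℤ) : ℝ) * _)
      rw [hflip, ← hN]
      congr 1
      push_cast
      ring
    · change F.flip.normal (π + (b * unitAngle n - a * unitAngle n)) =
        F.normal (((a - b : ℤ) : ℝ) * _)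
      rw [hflip]
      congr 1
      push_cast
      ring
  · fin_cases i
    · change F.normal (-(a * unitAngle n)) = F.normal (((-a : ℤ) : ℝ) * _)
      congr 1
      push_cast
      ring
    · change F.normal (b * unitAngle n) = F.normal (((b : ℤ) : ℝ) * _)
      congr 1
    · change F.normal (π + (b * unitAngle n - a * unitAngle n)) =
        F.normal (((2 * n + 1 + (b - a) : ℤ) : ℝ) * _)
      rw [← hN]
      congr 1
      push_cast
      ring

theorem exists_eq_of_normal_eq {n : ℕ} {k l : ℤ}
    (h : F.normal (k * unitAngle n) = F.normal (l * unitAngle n)) :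
    ∃ m : ℤ, k - l = 2 * (2 * n + 1) * m := by
  have h2 : √2 ≠ (0 : ℝ) := by positivity
  have hs := congrArg (fun x => inner ℝ x F.e) h
  have hc := congrArg (fun x => inner ℝ x F.f) h
  simp only [inner_normal_e, inner_normal_f] at hs hc
  have hs' := mul_left_cancel₀ h2 hs
  have hc' := mul_left_cancel₀ h2 (neg_injective hc)
  obtain ⟨m, hm⟩ := Real.Angle.angle_eq_iff_two_pi_dvd_sub.1 (Real.Angle.cos_sin_inj hc' hs')
  refine ⟨m, ?_⟩
  have hα := (unitAngle_pos n).ne'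
  rw [← two_mul_add_one_mul_unitAngle n] at hm
  have : ((k : ℝ) - l) = 2 * (2 * n + 1) * m := by
    refine mul_right_cancel₀ hα ?_
    linear_combination hm
  exact_mod_cast this

/-- The parameters of a seed are unique, and translations between seeds are parallel to the belt
line. -/
theorem eq_shift_of_seedOf_eq_translate {n : ℕ} {s t : SeedParam} (hs : s.Valid n)
    (ht : t.Valid n) {w : Plane} (h : F.seedOf n s = translate w (F.seedOf n t)) :
    s = t.shift (s.p - t.p) ∧ w = (s.p - t.p) • F.e := by
  obtain ⟨σ, hσ, -⟩ := Quotient.exact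
    (h : Quotient.mk _ _ = Quotient.mk _ ((F.labelledSeedOf n t).translate w))
  have hdir : ∀ i, direction n t i = direction n s (σ i) := by
    intro i
    obtain ⟨m, hm⟩ : ∃ m : ℤ, direction n t i - direction n s (σ i) = 2 * (2 * n + 1) * m := by
      refine F.exists_eq_of_normal_eq ?_
      rw [← labelledSeedOf_v_fst, ← labelledSeedOf_v_fst, ← hσ i]
      rfl
    have b₁ := direction_bounds ht i
    have b₂ := direction_bounds hs (σ i)
    have m₁ : m < 1 := by
      by_contra! hm'
      nlinarith
    have m₂ : -1 < m := by
      by_contra! hm'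
      nlinarith
    obtain rfl : m = 0 := by omega
    linarith
  -- The directions lie in [-n, -1], [0, n], [n+1, 3n] for one orientation and in [2n+2, 3n+1],
  -- [n+1, 2n+1], [1-n, n] for the other. The number of directions above n determines the
  -- orientation, and then the intervals determine the numbering.
  have key : s.ε = t.ε ∧ s.a = t.a ∧ s.b = t.b ∧ σ 0 = 0 ∧ σ 1 = 1 := by
    have h₀ := hdir 0
    have h₁ := hdir 1
    have h₂ := hdir 2
    have n₀ : σ 0 ≠ σ 1 := σ.injective.ne (by decide)
    have n₁ : σ 0 ≠ σ 2 := σ.injective.ne (by decide)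
    have n₂ : σ 1 ≠ σ 2 := σ.injective.ne (by decide)
    obtain ⟨ε, a, b, p⟩ := s
    obtain ⟨ε', a', b', p'⟩ := t
    obtain ⟨s₁, s₂, s₃⟩ := hs
    obtain ⟨t₁, t₂, t₃⟩ := ht
    simp only at s₁ s₂ s₃ t₁ t₂ t₃
    generalize σ 0 = i₀ at *
    generalize σ 1 = i₁ at *
    generalize σ 2 = i₂ at *
    clear h hσ hdir
    cases ε <;> cases ε' <;> fin_cases i₀ <;> fin_cases i₁ <;> fin_cases i₂ <;>
      simp [direction] at * <;> omega
  obtain ⟨hε, ha, hb, hσ0, hσ1⟩ := key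
  have hst : s = t.shift (s.p - t.p) := by
    ext <;> simp [SeedParam.shift, hε, ha, hb]
  refine ⟨hst, ?_⟩
  set u := s.p - t.p
  have hu : F.labelledSeedOf n s = (F.labelledSeedOf n t).translate (u • F.e) := by
    have := (F.orient t.ε).translate_state u (t.a * unitAngle n) (t.b * unitAngle n) t.p
    rw [orient_e] at this
    rw [labelledSeedOf, labelledSeedOf, this, hst]
    rfl
  have hinner : ∀ i, σ i = i →
      inner ℝ ((F.labelledSeedOf n t).v i).1 (w - u • F.e) = (0 : ℝ) := by
    intro i hi
    have h₁ := hσ i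
    rw [hi, hu] at h₁
    have h₂ := congrArg Prod.snd h₁
    simp only [LabelledSeed.translate, translateVector] at h₂
    rw [inner_sub_right]
    linarith
  obtain ⟨h₁, h₂, h₃⟩ := ht
  refine sub_eq_zero.1 ((F.orient t.ε).eq_zero_of_inner_normal_eq_zero
    (A := t.a * unitAngle n) (B := t.b * unitAngle n) ?_ (hinner 0 hσ0) (hinner 1 hσ1))
  have e₁ : 0 < (t.a : ℝ) * unitAngle n := mul_pos (by exact_mod_cast h₁) (unitAngle_pos n)
  have e₂ : 0 ≤ (t.b : ℝ) * unitAngle n := mul_nonneg (by positivity) (unitAngle_pos n).le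
  have e₃ := mul_unitAngle_lt h₂
  have e₄ := mul_unitAngle_lt h₃
  exact (sin_pos_of_pos_of_lt_pi (by linarith) (by linarith)).ne'

end BeltFrame

end

end AffineExchange

/-! ### The initial triangle in coordinates. -/

namespace AffineExchange

open Real Filter

noncomputable section

variable {T : Affine.Triangle ℝ Plane}

/-- The foot of an altitude is characterised by lying on the side and by orthogonality. -/
theorem altitudeFoot_eq {i j k : Fin 3} (hjk : j ≠ k) (hij : i ≠ j) (hik : i ≠ k)
    (hc : ({i}ᶜ : Set (Fin 3)) = {j, k}) {Q : Plane} (t : ℝ)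
    (hQ : Q = T.points j + t • (T.points k - T.points j))
    (ho : inner ℝ (T.points i - Q) (T.points k - T.points j) = (0 : ℝ)) :
    T.altitudeFoot i = Q := by
  have hmem := T.altitudeFoot_mem_affineSpan_image_compl i
  rw [hc, Set.image_pair] at hmem
  have hdir := AffineSubspace.vsub_mem_direction hmem (left_mem_affineSpan_pair ℝ _ _)
  rw [direction_affineSpan, mem_vectorSpan_pair_rev] at hdir
  obtain ⟨u, hu⟩ := hdir
  have hu' : T.altitudeFoot i = T.points j + u • (T.points k - T.points j) := by
    rw [vsub_eq_sub, vsub_eq_sub] at hu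
    rw [hu]
    abel
  have h₁ := T.inner_vsub_altitudeFoot_vsub_altitudeFoot_eq_zero hij
  have h₂ := T.inner_vsub_altitudeFoot_vsub_altitudeFoot_eq_zero hik
  simp only [vsub_eq_sub] at h₁ h₂
  have h₃ : inner ℝ (T.points k - T.points j) (T.points i - T.altitudeFoot i) = (0 : ℝ) := by
    have : T.points k - T.points j =
      (T.points k - T.altitudeFoot i) - (T.points j - T.altitudeFoot i) := by abel
    rw [this, inner_sub_left, h₁, h₂, sub_zero]
  rw [real_inner_comm] at h₃
  have h₄ : inner ℝ (T.altitudeFoot i - Q) (T.points k - T.points j) = (0 : ℝ) := by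
    have : T.altitudeFoot i - Q = (T.points i - Q) - (T.points i - T.altitudeFoot i) := by abel
    rw [this, inner_sub_left, ho, h₃, sub_zero]
  have h₅ : T.altitudeFoot i - Q = (u - t) • (T.points k - T.points j) := by
    rw [hu', hQ]
    module
  rw [h₅, inner_smul_left, real_inner_self_eq_norm_sq] at h₄
  have hne : ‖T.points k - T.points j‖ ^ 2 ≠ 0 := by
    refine pow_ne_zero _ (norm_ne_zero_iff.2 (sub_ne_zero.2 ?_))
    exact T.independent.injective.ne hjk.symm
  have h₆ : u - t = 0 := by simpa using (mul_eq_zero.1 h₄).resolve_right hne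
  rw [h₆, zero_smul] at h₅
  exact sub_eq_zero.1 h₅

theorem outerNormal_eq {i : Fin 3} {m : ℝ} {u : Plane} (hm : 0 < m) (hu : inner ℝ u u = (1 : ℝ))
    (h : T.altitudeFoot i - T.points i = m • u) : outerNormal T i = √2 • u := by
  have hu' : ‖u‖ = 1 := by
    rw [real_inner_self_eq_norm_sq] at hu
    nlinarith [norm_nonneg u]
  rw [outerNormal, h, norm_smul, hu', norm_of_nonneg hm.le, mul_one, smul_smul]
  congr 1
  field_simp

/-- Coordinates of the vertices of the initial triangle. -/
theorem exists_coordinates {n : ℕ} (hn : 1 ≤ n) (hT : IsInitialTriangle n T) :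
    ∃ (M g h : Plane) (l : ℝ), 0 < l ∧ inner ℝ g g = (1 : ℝ) ∧ inner ℝ h h = (1 : ℝ) ∧
      inner ℝ g h = (0 : ℝ) ∧
      T.points 0 = M + (l * sin (n * unitAngle n)) • h ∧
      T.points 1 = M + (l * cos (n * unitAngle n)) • g ∧
      T.points 2 = M - (l * cos (n * unitAngle n)) • g := by
  obtain ⟨hα, h₁, h₂⟩ := hT
  have hpos := unitAngle_pos n
  have hN := two_mul_add_one_mul_unitAngle n
  have hn' : (1 : ℝ) ≤ n := by exact_mod_cast hn
  have hlt := mul_unitAngle_lt (le_refl n)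
  have hc : 0 < cos (n * unitAngle n) := cos_pos_of_mem_Ioo ⟨by nlinarith, hlt⟩
  have hs : 0 < sin (n * unitAngle n) := sin_pos_of_pos_of_lt_pi (by positivity) (by linarith [pi_pos])
  have hdist : dist (T.points 0) (T.points 1) = dist (T.points 0) (T.points 2) := by
    refine EuclideanGeometry.dist_eq_of_angle_eq_angle_of_angle_ne_pi (h₁.trans h₂.symm) ?_
    rw [hα]
    change unitAngle n ≠ π
    nlinarith
  set M : Plane := (1 / 2 : ℝ) • (T.points 1 + T.points 2) with hM
  set x : Plane := T.points 1 - M with hx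
  set y : Plane := T.points 0 - M with hy
  have hx2 : T.points 2 - M = -x := by rw [hx, hM]; module
  have e01 : T.points 0 - T.points 1 = y - x := by rw [hx, hy]; abel
  have e02 : T.points 0 - T.points 2 = y + x := by
    rw [← sub_neg_eq_add, ← hx2, hy]; abel
  have e21 : T.points 2 - T.points 1 = (-2 : ℝ) • x := by
    rw [hx, hM]; module
  have hxy : inner ℝ x y = (0 : ℝ) := by
    rw [dist_eq_norm, dist_eq_norm, e01, e02] at hdist
    have h₃ := norm_sub_sq_real y x
    have h₄ := norm_add_sq_real y x
    rw [hdist] at h₃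
    rw [real_inner_comm]
    linarith
  have hxpos : 0 < ‖x‖ := by
    refine norm_pos_iff.2 fun h0 => ?_
    have : T.points 2 = T.points 1 := sub_eq_zero.1 (by rw [e21, h0, smul_zero])
    exact absurd (T.independent.injective this) (by decide)
  -- Half of the base, of length ‖x‖, is the projection of a leg, of length ‖y - x‖.
  have hang : cos (n * unitAngle n) * ‖y - x‖ = ‖x‖ := by
    have h₃ := InnerProductGeometry.cos_angle_mul_norm_mul_norm (T.points 0 - T.points 1)
      (T.points 2 - T.points 1)
    have h₄ : InnerProductGeometry.angle (T.points 0 - T.points 1) (T.points 2 - T.points 1) =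
      n * unitAngle n := h₁
    rw [h₄, e01, e21, norm_smul, inner_smul_right, inner_sub_left, real_inner_comm, hxy,
      real_inner_self_eq_norm_sq] at h₃
    have h₅ : ‖(-2 : ℝ)‖ = 2 := by norm_num
    rw [h₅] at h₃
    refine mul_right_cancel₀ (mul_pos two_pos hxpos).ne' ?_
    linarith
  have hl : 0 < ‖y - x‖ := by
    rcases (norm_nonneg (y - x)).eq_or_lt with h | h
    · rw [← h, mul_zero] at hang
      linarith
    · exact h
  have hy' : ‖y‖ = ‖y - x‖ * sin (n * unitAngle n) := by
    have h₃ := norm_sub_sq_real y x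
    rw [real_inner_comm, hxy] at h₃
    have h₄ : ‖y‖ ^ 2 = (‖y - x‖ * sin (n * unitAngle n)) ^ 2 := by
      rw [mul_pow, sin_sq]
      rw [← hang] at h₃
      linarith
    exact (sq_eq_sq₀ (norm_nonneg _) (by positivity)).1 h₄
  have hypos : 0 < ‖y‖ := by rw [hy']; positivity
  refine ⟨M, ‖x‖⁻¹ • x, ‖y‖⁻¹ • y, ‖y - x‖, hl, ?_, ?_, ?_, ?_, ?_, ?_⟩
  · rw [real_inner_smul_left, real_inner_smul_right, real_inner_self_eq_norm_sq]
    field_simp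
  · rw [real_inner_smul_left, real_inner_smul_right, real_inner_self_eq_norm_sq]
    field_simp
  · rw [real_inner_smul_left, real_inner_smul_right, hxy]
    simp
  · rw [← hy', smul_inv_smul₀ hypos.ne', hy]
    abel
  · rw [mul_comm, hang, smul_inv_smul₀ hxpos.ne', hx]
    abel
  · rw [mul_comm, hang, smul_inv_smul₀ hxpos.ne', sub_eq_iff_eq_add.1 hx2]
    abel

theorem sideVector_eq_vec (F : BeltFrame T) {i : Fin 3} {θ c : ℝ}
    (hn : outerNormal T i = F.normal θ)
    (hc : inner ℝ (F.normal θ) (T.altitudeFoot i - F.O) = -(√2 * c)) :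
    sideVector T i = F.vec θ c := by
  rw [inner_sub_right] at hc
  simp only [sideVector, BeltFrame.vec, hn]
  congr 1
  linarith

/-- The initial seed in terms of the parameters. -/
theorem exists_beltFrame {n : ℕ} (hn : 1 ≤ n) (hT : IsInitialTriangle n T) :
    ∃ F : BeltFrame T, F.e = beltDirection T ∧
      initialSeed n T = F.seedOf n ⟨true, 1, n, 0⟩ := by
  obtain ⟨M, g, h, l, hl, hg, hh, hgh, h0, h1, h2⟩ := exists_coordinates hn hT
  have hpos := unitAngle_pos n
  have hN := two_mul_add_one_mul_unitAngle n
  have hn' : (1 : ℝ) ≤ n := by exact_mod_cast hn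
  have hlt := mul_unitAngle_lt (le_refl n)
  set α := unitAngle n with hαdef
  have hc : 0 < cos (n * α) := cos_pos_of_mem_Ioo ⟨by nlinarith, hlt⟩
  have hs : 0 < sin (n * α) := sin_pos_of_pos_of_lt_pi (by positivity) (by linarith [pi_pos])
  have hsα : 0 < sin α := sin_pos_of_pos_of_lt_pi hpos (by nlinarith)
  have hα2 : α = π - 2 * (n * α) := by linarith
  have hcosα : cos α = 1 - 2 * cos (n * α) ^ 2 := by
    conv_lhs => rw [hα2, cos_pi_sub, cos_two_mul]
    ring
  have hsinα : sin α = 2 * sin (n * α) * cos (n * α) := by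
    conv_lhs => rw [hα2, sin_pi_sub, sin_two_mul]
  have hhg : inner ℝ h g = (0 : ℝ) := by rw [real_inner_comm, hgh]
  have hinner : ∀ a b c d : ℝ, inner ℝ (a • g + b • h) (c • g + d • h) = a * c + b * d := by
    intro a b c d
    simp only [inner_add_left, inner_add_right, real_inner_smul_left, real_inner_smul_right, hg,
      hh, hgh, hhg]
    ring
  set c := cos (n * α) with hcdef
  set s := sin (n * α) with hsdef
  have hsc : s ^ 2 + c ^ 2 = 1 := sin_sq_add_cos_sq _
  have hg' : g = (1 : ℝ) • g + (0 : ℝ) • h := by simp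
  have hf0 : T.altitudeFoot 0 = M := by
    refine altitudeFoot_eq (j := 1) (k := 2) (by decide) (by decide) (by decide)
      (by ext x; fin_cases x <;> simp) (1 / 2) ?_ ?_
    · rw [h1, h2]
      module
    · have e₁ : T.points 0 - M = (0 : ℝ) • g + (l * s) • h := by rw [h0]; module
      have e₂ : T.points 2 - T.points 1 = (-(2 * (l * c))) • g + (0 : ℝ) • h := by
        rw [h1, h2]; module
      rw [e₁, e₂, hinner]
      ring
  -- The base has length 2lc, so its projection to the leg of length l is 2lc²; the foot divides the
  -- leg at 2c².
  have hf2 : T.altitudeFoot 2 = M + ((l * c) * cos α) • g + ((l * c) * sin α) • h := by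
    refine altitudeFoot_eq (j := 1) (k := 0) (by decide) (by decide) (by decide)
      (by ext x; fin_cases x <;> simp) (2 * c ^ 2) ?_ ?_
    · rw [h1, h0, hcosα, hsinα]
      module
    · have e₁ : T.points 2 - (M + ((l * c) * cos α) • g + ((l * c) * sin α) • h) =
          (-(l * c) - (l * c) * cos α) • g + (-((l * c) * sin α)) • h := by
        rw [h2]; module
      have e₂ : T.points 0 - T.points 1 = (-(l * c)) • g + (l * s) • h := by
        rw [h0, h1]; module
      rw [e₁, e₂, hinner, hcosα, hsinα]
      linear_combination (-2 * l ^ 2 * c ^ 2) * hsc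
  have hf1 : T.altitudeFoot 1 = M + (-((l * c) * cos α)) • g + ((l * c) * sin α) • h := by
    refine altitudeFoot_eq (j := 2) (k := 0) (by decide) (by decide) (by decide)
      (by ext x; fin_cases x <;> simp) (2 * c ^ 2) ?_ ?_
    · rw [h2, h0, hcosα, hsinα]
      module
    · have e₁ : T.points 1 - (M + (-((l * c) * cos α)) • g + ((l * c) * sin α) • h) =
          ((l * c) + (l * c) * cos α) • g + (-((l * c) * sin α)) • h := by
        rw [h1]; module
      have e₂ : T.points 0 - T.points 2 = (l * c) • g + (l * s) • h := by
        rw [h0, h2]; module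
      rw [e₁, e₂, hinner, hcosα, hsinα]
      linear_combination (-2 * l ^ 2 * c ^ 2) * hsc
  have hbelt : T.altitudeFoot 2 - T.altitudeFoot 0 = (l * c) • (cos α • g + sin α • h) := by
    rw [hf2, hf0]; module
  have hee : inner ℝ (cos α • g + sin α • h) (cos α • g + sin α • h) = (1 : ℝ) := by
    rw [hinner]
    linarith [sin_sq_add_cos_sq α]
  -- The belt line makes the angle α with the base. The origin is H₀, the midpoint of the base, and
  -- r is the distance from H₀ to H₂. With the circumradius R one has l = 2Rs, so K is 2R times the
  -- product of the sines of the three angles.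
  let F : BeltFrame T :=
    { e := cos α • g + sin α • h
      f := (-sin α) • g + cos α • h
      O := M
      K := l * s * sin α
      r := l * c
      inner_e_e := hee
      inner_f_f := by rw [hinner]; linarith [sin_sq_add_cos_sq α]
      inner_e_f := by rw [hinner]; ring
      K_pos := by positivity
      r_pos := by positivity
      beltLine_eq := fun t => by
        rw [beltLine, AffineMap.lineMap_apply, vsub_eq_sub, vadd_eq_add, hbelt, hf0, smul_smul,
          add_comm] }
  have hnormal : ∀ θ, F.normal θ = √2 • (sin (θ + α) • g + (-cos (θ + α)) • h) := by
    intro θ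
    change √2 • (sin θ • (cos α • g + sin α • h) - cos θ • ((-sin α) • g + cos α • h)) = _
    rw [sin_add, cos_add]
    module
  have hnα : sin (n * α + α) = s := by
    rw [show n * α + α = π - n * α by linarith, sin_pi_sub]
  have hnα' : cos (n * α + α) = -c := by
    rw [show n * α + α = π - n * α by linarith, cos_pi_sub]
  have n0 : outerNormal T 0 = F.normal (-α) := by
    rw [hnormal, neg_add_cancel, sin_zero, cos_zero]
    refine outerNormal_eq (m := l * s) (by positivity) (by rw [hinner]; ring) ?_
    rw [hf0, h0]
    module
  have n2 : outerNormal T 2 = F.normal (n * α) := by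
    rw [hnormal, hnα, hnα']
    refine outerNormal_eq (m := 2 * l * c * s) (by positivity)
      (by rw [hinner]; linear_combination hsc) ?_
    rw [hf2, h2, hsinα, hcosα, show 1 - 2 * c ^ 2 = 2 * s ^ 2 - 1 by linear_combination -2 * hsc]
    module
  have n1 : outerNormal T 1 = F.normal (π + (n * α - α)) := by
    rw [hnormal, show π + (n * α - α) + α = n * α + π by ring, sin_add_pi, cos_add_pi]
    refine outerNormal_eq (m := 2 * l * c * s) (by positivity)
      (by rw [hinner]; linear_combination hsc) ?_
    rw [hf1, h1, hsinα, hcosα, show 1 - 2 * c ^ 2 = 2 * s ^ 2 - 1 by linear_combination -2 * hsc]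
    module
  refine ⟨F, ?_, ?_⟩
  · have hnorm : ‖cos α • g + sin α • h‖ = 1 := by
      rw [real_inner_self_eq_norm_sq] at hee
      nlinarith [norm_nonneg (cos α • g + sin α • h)]
    rw [beltDirection, hbelt, norm_smul, hnorm, norm_of_nonneg (by positivity), mul_one, smul_smul,
      one_div, inv_mul_cancel₀ (by positivity), one_smul]
  · have v0 : sideVector T 0 = (F.labelledSeedOf n ⟨true, 1, n, 0⟩).v 0 := by
      change _ = F.vec (-((1 : ℕ) * α)) (0 * sin ((1 : ℕ) * α))
      rw [Nat.cast_one, one_mul, zero_mul]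
      refine sideVector_eq_vec F n0 ?_
      rw [hf0, show F.O = M from rfl, sub_self, inner_zero_right]
      ring
    have v2 : sideVector T 2 = (F.labelledSeedOf n ⟨true, 1, n, 0⟩).v 1 := by
      change _ = F.vec (n * α)
        (-(0 * sin (n * α)) + F.K * cos ((1 : ℕ) * α + n * α) / sin ((1 : ℕ) * α))
      rw [Nat.cast_one, one_mul, zero_mul, add_comm α, hnα']
      refine sideVector_eq_vec F n2 ?_
      have e₁ : T.altitudeFoot 2 - F.O = ((l * c) * cos α) • g + ((l * c) * sin α) • h := by
        rw [hf2, show F.O = M from rfl]; abel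
      rw [hnormal, hnα, hnα', e₁, real_inner_smul_left, hinner,
        show F.K = l * s * sin α from rfl]
      field_simp
      rw [hcosα, hsinα]
      ring
    have v1 : sideVector T 1 = (F.labelledSeedOf n ⟨true, 1, n, 0⟩).v 2 := by
      change _ = F.vec (π + (n * α - (1 : ℕ) * α))
        (0 * sin (n * α - (1 : ℕ) * α) - F.K * cos (n * α) / sin ((1 : ℕ) * α))
      rw [Nat.cast_one, one_mul, zero_mul]
      refine sideVector_eq_vec F n1 ?_
      have e₁ : T.altitudeFoot 1 - F.O = (-((l * c) * cos α)) • g + ((l * c) * sin α) • h := by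
        rw [hf1, show F.O = M from rfl]; abel
      rw [hnormal, show π + (n * α - α) + α = n * α + π by ring, sin_add_pi, cos_add_pi, e₁,
        real_inner_smul_left, hinner, show F.K = l * s * sin α from rfl]
      field_simp
      rw [hcosα, hsinα]
      ring
    -- The normal form has its sink at index 1, the initial seed at index 2.
    refine mk_eq_mk_of_perm (Equiv.swap 1 2) (fun i => ?_) fun i j => ?_
    · fin_cases i
      · exact v0.symm
      · exact v2.symm
      · exact v1.symm
    · change BeltFrame.stateMatrix ((1 : ℕ) * α) (n * α) i j = initialMatrix n _ _
      rw [Nat.cast_one, one_mul]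
      have hα' : π / (2 * (n : ℝ) + 1) = α := rfl
      fin_cases i <;> fin_cases j <;>
        simp [BeltFrame.stateMatrix, initialMatrix, Equiv.swap_apply_def, hα', add_comm α, hnα',
          ← hcdef]

end

end AffineExchange

/-! ### Linear independence of the numbers 1 / sin²(kα). -/

namespace AffineExchange

open Real Filter

noncomputable section

/-- The number `1 / sin² (m α)`, where `α = π / (2 n + 1)`. -/
def cosecSq (n : ℕ) (m : ℤ) : ℝ := 1 / sin (m * unitAngle n) ^ 2

theorem cosecSq_nonneg (n : ℕ) (m : ℤ) : 0 ≤ cosecSq n m := by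
  unfold cosecSq; positivity

theorem cosecSq_congr {n : ℕ} {m m' : ℤ} (h : (m : ZMod (2 * n + 1)) = m') :
    cosecSq n m = cosecSq n m' := by
  rw [ZMod.intCast_eq_intCast_iff_dvd_sub] at h
  obtain ⟨q, hq⟩ := h
  have h₁ : (m' : ℝ) * unitAngle n = m * unitAngle n + q * π := by
    rw [← two_mul_add_one_mul_unitAngle n]
    have : (m' : ℝ) - m = (2 * n + 1) * q := by exact_mod_cast hq
    linear_combination unitAngle n * this
  rw [cosecSq, cosecSq, h₁, sin_add_int_mul_pi, mul_pow, ← zpow_natCast ((-1 : ℝ) ^ q), ← zpow_mul,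
    mul_comm q, zpow_mul]
  norm_num

theorem cosecSq_natAbs (n : ℕ) (m : ℤ) : cosecSq n m.natAbs = cosecSq n m := by
  rcases Int.natAbs_eq m with h | h
  · rw [← h]
  · conv_rhs => rw [h]
    simp [cosecSq]

/-- The value depends only on the residue of m modulo 2n + 1 up to sign, so every index can be moved
into the range from 0 to n. -/
theorem cosecSq_valMinAbs (n : ℕ) (m : ℤ) :
    cosecSq n ((m : ZMod (2 * n + 1)).valMinAbs.natAbs : ℕ) = cosecSq n m := by
  rw [cosecSq_natAbs]
  exact cosecSq_congr (ZMod.coe_valMinAbs _)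

/-- The identity sin(x - α/2) sin(x + α/2) = sin² x - sin²(α/2) bounds the term by the reciprocal of
the left side, which is a difference of cotangents; the bound telescopes. -/
theorem cosecSq_le {n m : ℕ} (hm : 1 ≤ m) (hmn : m ≤ n) :
    cosecSq n m ≤ 1 / sin (unitAngle n) *
      (cot ((m - 1 / 2) * unitAngle n) - cot ((m + 1 / 2) * unitAngle n)) := by
  have hpos := unitAngle_pos n
  have hN := two_mul_add_one_mul_unitAngle n
  have h1 : (1 : ℝ) ≤ m := by exact_mod_cast hm
  have h2 : (m : ℝ) ≤ n := by exact_mod_cast hmn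
  set α := unitAngle n
  have s1 : 0 < sin ((m - 1 / 2) * α) := sin_pos_of_pos_of_lt_pi (by nlinarith) (by nlinarith)
  have s2 : 0 < sin ((m + 1 / 2) * α) := sin_pos_of_pos_of_lt_pi (by nlinarith) (by nlinarith)
  have s3 : 0 < sin (m * α) := sin_pos_of_pos_of_lt_pi (by nlinarith) (by nlinarith)
  have s4 : 0 < sin α := sin_pos_of_pos_of_lt_pi (by nlinarith) (by nlinarith)
  have e1 : sin α = sin ((m + 1 / 2) * α) * cos ((m - 1 / 2) * α)
      - cos ((m + 1 / 2) * α) * sin ((m - 1 / 2) * α) := by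
    rw [← sin_sub]
    congr 1
    ring
  have e2 : 1 / sin α * (cot ((m - 1 / 2) * α) - cot ((m + 1 / 2) * α)) =
      1 / (sin ((m - 1 / 2) * α) * sin ((m + 1 / 2) * α)) := by
    rw [cot_eq_cos_div_sin, cot_eq_cos_div_sin]
    generalize ((m : ℝ) - 1 / 2) * α = x at s1 e1 ⊢
    generalize ((m : ℝ) + 1 / 2) * α = y at s2 e1 ⊢
    field_simp
    linarith
  have e3 : sin ((m - 1 / 2) * α) * sin ((m + 1 / 2) * α) ≤ sin (m * α) ^ 2 := by
    have h₁ : (m - 1 / 2) * α = m * α - α / 2 := by ring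
    have h₂ : (m + 1 / 2) * α = m * α + α / 2 := by ring
    rw [h₁, h₂, sin_sub, sin_add]
    have h₃ := sin_sq_add_cos_sq (α / 2)
    have h₄ := sin_sq_add_cos_sq (m * α)
    have h₅ : (sin (m * α) * cos (α / 2) - cos (m * α) * sin (α / 2)) *
        (sin (m * α) * cos (α / 2) + cos (m * α) * sin (α / 2)) =
        sin (m * α) ^ 2 - sin (α / 2) ^ 2 := by
      linear_combination sin (m * α) ^ 2 * h₃ - sin (α / 2) ^ 2 * h₄
    rw [h₅]
    nlinarith [sq_nonneg (sin (α / 2))]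
  rw [e2, cosecSq, Int.cast_natCast]
  exact one_div_le_one_div_of_le (mul_pos s1 s2) e3

/-- The first term dominates the sum of the others. -/
theorem sum_cosecSq_lt {n : ℕ} (hn : 1 ≤ n) :
    ∑ m ∈ Finset.Icc 2 n, cosecSq n (m : ℕ) < cosecSq n 1 := by
  have hpos := unitAngle_pos n
  have hN := two_mul_add_one_mul_unitAngle n
  have hn' : (1 : ℝ) ≤ n := by exact_mod_cast hn
  have key : ∀ k, 1 ≤ k → k ≤ n → ∑ m ∈ Finset.Icc 2 k, cosecSq n (m : ℕ) ≤
      1 / sin (unitAngle n) * (cot (3 / 2 * unitAngle n) - cot ((k + 1 / 2) * unitAngle n)) := by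
    intro k hk
    induction k, hk using Nat.le_induction with
    | base =>
      intro _
      norm_num
    | succ k hk ih =>
      intro hkn
      rw [Finset.sum_Icc_succ_top (by omega)]
      refine (add_le_add (ih (by omega)) (cosecSq_le (by omega) hkn)).trans (le_of_eq ?_)
      push_cast
      rw [show (k : ℝ) + 1 - 1 / 2 = k + 1 / 2 by ring]
      ring
  refine (key n hn le_rfl).trans_lt ?_
  -- At the upper end of the telescoping sum the cotangent vanishes.
  have h1 : (n + 1 / 2 : ℝ) * unitAngle n = π / 2 := by linarith
  rw [h1, cot_eq_cos_div_sin (π / 2), cos_pi_div_two, zero_div, sub_zero, cot_eq_cos_div_sin,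
    cosecSq, Int.cast_one, one_mul]
  set α := unitAngle n
  have s3 : 0 < sin (3 / 2 * α) := sin_pos_of_pos_of_lt_pi (by nlinarith) (by nlinarith)
  have s4 : 0 < sin α := sin_pos_of_pos_of_lt_pi (by nlinarith) (by nlinarith)
  have e : sin α * cos (3 / 2 * α) < sin (3 / 2 * α) := by
    rcases le_or_gt (cos (3 / 2 * α)) 0 with h | h
    · nlinarith
    · have h₂ : sin α < sin (3 / 2 * α) := by
        refine sin_lt_sin_of_lt_of_le_pi_div_two (by linarith [pi_pos]) ?_ (by linarith)
        nlinarith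
      have h₃ := cos_le_one (3 / 2 * α)
      nlinarith
  rw [div_mul_div_comm, one_mul, div_lt_div_iff₀ (by positivity) (by positivity), one_mul]
  nlinarith

/-- The indices of a basis: the residues prime to `2 n + 1`, up to sign. -/
def unitIndices (n : ℕ) : Finset ℕ := {k ∈ Finset.Icc 1 n | (2 * n + 1).Coprime k}

/-- The residues prime to 2n + 1 come in pairs k, 2n + 1 - k, exactly one of which is at most n. -/
theorem two_mul_card_unitIndices {n : ℕ} (hn : 1 ≤ n) :
    2 * (unitIndices n).card = Nat.totient (2 * n + 1) := by
  have h : {a ∈ Finset.range (2 * n + 1) | (2 * n + 1).Coprime a} =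
      unitIndices n ∪ (unitIndices n).image fun k => 2 * n + 1 - k := by
    ext a
    simp only [unitIndices, Finset.mem_filter, Finset.mem_range, Finset.mem_union, Finset.mem_Icc,
      Finset.mem_image]
    constructor
    · rintro ⟨h₁, h₂⟩
      have h₃ : a ≠ 0 := by
        rintro rfl
        simp at h₂
        omega
      by_cases h₄ : a ≤ n
      · exact Or.inl ⟨⟨by omega, h₄⟩, h₂⟩
      · refine Or.inr ⟨2 * n + 1 - a, ⟨⟨by omega, by omega⟩, ?_⟩, by omega⟩
        exact (Nat.coprime_self_sub_right (by omega)).2 h₂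
    · rintro (⟨⟨h₁, h₂⟩, h₃⟩ | ⟨k, ⟨⟨h₁, h₂⟩, h₃⟩, rfl⟩)
      · exact ⟨by omega, h₃⟩
      · exact ⟨by omega, (Nat.coprime_self_sub_right (by omega)).2 h₃⟩
  rw [Nat.totient_eq_card_coprime, h, Finset.card_union_of_disjoint, Finset.card_image_of_injOn]
  · ring
  · intro x hx y hy hxy
    simp only [unitIndices, Finset.coe_filter, Finset.mem_Icc, Set.mem_ofPred_eq] at hx hy hxy
    omega
  · rw [Finset.disjoint_left]
    intro x hx hy
    simp only [unitIndices, Finset.mem_filter, Finset.mem_Icc, Finset.mem_image] at hx hy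
    omega

/-- A rational function of ζ over ℚ: squaring the sine removes the factor i and the half angle.
Hence Galois conjugation ζ ↦ ζ^j multiplies the index by j. -/
theorem ofReal_cosecSq (n : ℕ) (m : ℤ) :
    ((cosecSq n m : ℝ) : ℂ) = -4 * Complex.exp (2 * π * Complex.I / (2 * n + 1 : ℕ)) ^ m /
      (Complex.exp (2 * π * Complex.I / (2 * n + 1 : ℕ)) ^ m - 1) ^ 2 := by
  have hα : ((unitAngle n : ℝ) : ℂ) = π / (2 * n + 1) := by
    rw [unitAngle]; push_cast; rfl
  set x : ℂ := Complex.exp (m * (π / (2 * n + 1)) * Complex.I) with hx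
  have hx0 : x ≠ 0 := Complex.exp_ne_zero _
  have h₁ : Complex.exp (2 * π * Complex.I / (2 * n + 1 : ℕ)) ^ m = x ^ 2 := by
    rw [← Complex.exp_int_mul, hx, ← Complex.exp_nat_mul]
    congr 1
    push_cast
    ring
  have h₂ : Complex.sin (m * (π / (2 * n + 1))) = (x⁻¹ - x) * Complex.I / 2 := by
    rw [Complex.sin, hx, ← Complex.exp_neg, neg_mul]
  rw [h₁, cosecSq]
  push_cast
  rw [hα, h₂]
  have h₃ : ((x⁻¹ - x) * Complex.I / 2) ^ 2 = -(x ^ 2 - 1) ^ 2 / (4 * x ^ 2) := by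
    field_simp
    rw [Complex.I_sq]
    ring
  rw [h₃, one_div_div, div_neg, neg_mul, neg_div]

/-- Galois conjugation of rational linear relations. -/
theorem sum_cosecSq_mul_eq_zero {n j : ℕ} (hj : (2 * n + 1).Coprime j) {s : Finset ℕ} {q : ℕ → ℚ}
    (h : ∑ k ∈ s, (q k : ℝ) * cosecSq n (k : ℕ) = 0) :
    ∑ k ∈ s, (q k : ℝ) * cosecSq n (j * k : ℕ) = 0 := by
  set ζ : ℂ := Complex.exp (2 * π * Complex.I / (2 * n + 1 : ℕ)) with hζ
  have hprim : IsPrimitiveRoot ζ (2 * n + 1) := Complex.isPrimitiveRoot_exp _ (by omega)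
  have : NeZero ((2 * n + 1 : ℕ) : ℚ) := ⟨by positivity⟩
  obtain ⟨L, _, _, _⟩ : ∃ (L : Type) (_ : Field L) (_ : Algebra ℚ L),
      IsCyclotomicExtension {2 * n + 1} ℚ L :=
    ⟨CyclotomicField (2 * n + 1) ℚ, _, _, CyclotomicField.isCyclotomicExtension (2 * n + 1) ℚ⟩
  have hξ := IsCyclotomicExtension.zeta_spec (2 * n + 1) ℚ L
  set ξ := IsCyclotomicExtension.zeta (2 * n + 1) ℚ L
  have hirr : Irreducible (Polynomial.cyclotomic (2 * n + 1) ℚ) :=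
    Polynomial.cyclotomic.irreducible_rat (by omega)
  have hemb : ∀ z : ℂ, IsPrimitiveRoot z (2 * n + 1) → ∃ φ : L →ₐ[ℚ] ℂ, φ ξ = z := by
    intro z hz
    refine ⟨(hξ.embeddingsEquivPrimitiveRoots ℂ hirr).symm
      ⟨z, (mem_primitiveRoots (by omega)).2 hz⟩, ?_⟩
    rw [← hξ.embeddingsEquivPrimitiveRoots_apply_coe ℂ hirr, Equiv.apply_symm_apply]
  have hmap : ∀ (φ : L →ₐ[ℚ] ℂ) (i : ℕ), φ ξ = ζ ^ i →
      φ (∑ k ∈ s, algebraMap ℚ L (q k) * (-4 * ξ ^ k / (ξ ^ k - 1) ^ 2)) =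
        ((∑ k ∈ s, (q k : ℝ) * cosecSq n (i * k : ℕ) : ℝ) : ℂ) := by
    intro φ i hi
    rw [map_sum, Complex.ofReal_sum]
    refine Finset.sum_congr rfl fun k _ => ?_
    rw [Complex.ofReal_mul, ofReal_cosecSq, zpow_natCast, ← hζ, map_mul, AlgHom.commutes, map_div₀,
      map_mul, map_pow, map_pow, map_sub, map_pow, hi, map_one, map_neg, map_ofNat, pow_mul]
    simp
  obtain ⟨φ, hφ⟩ := hemb ζ hprim
  obtain ⟨ψ, hψ⟩ := hemb (ζ ^ j) (hprim.pow_of_coprime j hj.symm)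
  have h₁ := hmap φ 1 (by rw [hφ, pow_one])
  simp only [one_mul, h, Complex.ofReal_zero] at h₁
  have h₂ := hmap ψ j hψ
  -- The relation is pulled back along the embedding ξ ↦ ζ, which is injective, and pushed forward
  -- along ξ ↦ ζ^j.
  rw [(map_eq_zero_iff φ φ.toRingHom.injective).1 h₁, map_zero] at h₂
  exact_mod_cast h₂.symm

/-- The numbers `1 / sin² (k α)`, for `k` prime to `2 n + 1` up to sign, are linearly independent
over the rationals. -/
theorem linearIndependent_cosecSq {n : ℕ} (hn : 1 ≤ n) :
    LinearIndependent ℚ fun k : unitIndices n => cosecSq n (k : ℕ) := by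
  have hN : Fact (1 < 2 * n + 1) := ⟨by omega⟩
  have key : ∀ q : ℕ → ℚ, ∑ k ∈ unitIndices n, (q k : ℝ) * cosecSq n (k : ℕ) = 0 →
      ∀ k ∈ unitIndices n, q k = 0 := by
    intro q hq
    by_contra! hne
    obtain ⟨k₁, hk₁, hk₁'⟩ := hne
    obtain ⟨k₀, hk₀, hmax⟩ := (unitIndices n).exists_max_image (fun k => |q k|) ⟨k₁, hk₁⟩
    have hq₀ : 0 < |(q k₀ : ℝ)| := by
      have : 0 < |q k₀| := (abs_pos.2 hk₁').trans_le (hmax k₁ hk₁)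
      exact_mod_cast this
    have hmem : ∀ {k}, k ∈ unitIndices n ↔ (1 ≤ k ∧ k ≤ n) ∧ (2 * n + 1).Coprime k := by
      intro k
      simp [unitIndices]
    -- Conjugation by the inverse of k₀ moves the coefficient of largest modulus to index 1, and the
    -- other indices injectively into 2, …, n.
    set u : (ZMod (2 * n + 1))ˣ := (ZMod.unitOfCoprime k₀ (hmem.1 hk₀).2.symm)⁻¹ with hu
    set j : ℕ := (u : ZMod (2 * n + 1)).val with hj
    have hjc : (2 * n + 1).Coprime j := (ZMod.val_coe_unit_coprime u).symm
    have hju : ((j : ℕ) : ZMod (2 * n + 1)) = u := ZMod.natCast_zmod_val _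
    have hjk₀ : ((j * k₀ : ℕ) : ZMod (2 * n + 1)) = 1 := by
      rw [Nat.cast_mul, hju, hu, ← ZMod.coe_unitOfCoprime k₀ (hmem.1 hk₀).2.symm, Units.inv_mul]
    let ρ : ℕ → ℕ := fun k => ((j * k : ℕ) : ZMod (2 * n + 1)).valMinAbs.natAbs
    have hρ : ∀ k, cosecSq n (ρ k) = cosecSq n (j * k : ℕ) := fun k => by
      have := cosecSq_valMinAbs n (j * k : ℕ)
      rwa [Int.cast_natCast] at this
    have hρinj : ∀ k ∈ unitIndices n, ∀ l ∈ unitIndices n, ρ k = ρ l → k = l := by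
      intro k hk l hl h
      have hk' := hmem.1 hk
      have hl' := hmem.1 hl
      have vk : (k : ZMod (2 * n + 1)).valMinAbs = k := ZMod.valMinAbs_natCast_of_le_half (by omega)
      have vl : (l : ZMod (2 * n + 1)).valMinAbs = l := ZMod.valMinAbs_natCast_of_le_half (by omega)
      have h' : (k : ZMod (2 * n + 1)).valMinAbs.natAbs = (l : ZMod (2 * n + 1)).valMinAbs.natAbs := by
        rw [ZMod.natAbs_valMinAbs_eq_natAbs_valMinAbs]
        refine (ZMod.natAbs_valMinAbs_eq_natAbs_valMinAbs.1 h).imp (fun e => ?_) fun e => ?_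
        · rw [Nat.cast_mul, Nat.cast_mul, hju] at e
          exact u.isUnit.mul_left_cancel e
        · rw [Nat.cast_mul, Nat.cast_mul, hju, ← mul_neg] at e
          exact u.isUnit.mul_left_cancel e
      rw [vk, vl] at h'
      simpa using h'
    have hρ₀ : ρ k₀ = 1 := by
      simp only [ρ, hjk₀]
      have : ((1 : ℕ) : ZMod (2 * n + 1)).valMinAbs = (1 : ℕ) :=
        ZMod.valMinAbs_natCast_of_le_half (by omega)
      rw [Nat.cast_one] at this
      rw [this]
      rfl
    have hsub : ((unitIndices n).erase k₀).image ρ ⊆ Finset.Icc 2 n := by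
      intro m hm
      obtain ⟨k, hk, rfl⟩ := Finset.mem_image.1 hm
      obtain ⟨hk1, hk2⟩ := Finset.mem_erase.1 hk
      have h₁ : ρ k ≤ n := (ZMod.natAbs_valMinAbs_le _).trans (by omega)
      have h₂ : ρ k ≠ 1 := fun h => hk1 (hρinj k hk2 k₀ hk₀ (h.trans hρ₀.symm))
      have h₃ : ρ k ≠ 0 := by
        intro h
        have h₀ := (ZMod.valMinAbs_eq_zero _).1 (Int.natAbs_eq_zero.1 h)
        rw [ZMod.natCast_eq_zero_iff] at h₀
        have := Nat.Coprime.eq_one_of_dvd (hjc.mul_right (hmem.1 hk2).2) h₀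
        omega
      exact Finset.mem_Icc.2 ⟨by omega, h₁⟩
    have hsum := sum_cosecSq_mul_eq_zero hjc hq
    rw [← Finset.add_sum_erase _ _ hk₀, ← hρ k₀, hρ₀] at hsum
    have hbound : |∑ k ∈ (unitIndices n).erase k₀, (q k : ℝ) * cosecSq n (j * k : ℕ)| ≤
        |(q k₀ : ℝ)| * ∑ m ∈ Finset.Icc 2 n, cosecSq n (m : ℕ) := by
      calc _ ≤ ∑ k ∈ (unitIndices n).erase k₀, |(q k : ℝ) * cosecSq n (j * k : ℕ)| :=
            Finset.abs_sum_le_sum_abs _ _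
        _ ≤ ∑ k ∈ (unitIndices n).erase k₀, |(q k₀ : ℝ)| * cosecSq n (ρ k : ℕ) := by
            refine Finset.sum_le_sum fun k hk => ?_
            rw [abs_mul, hρ, abs_of_nonneg (cosecSq_nonneg _ _)]
            refine mul_le_mul_of_nonneg_right ?_ (cosecSq_nonneg _ _)
            exact_mod_cast hmax k (Finset.mem_of_mem_erase hk)
        _ = |(q k₀ : ℝ)| * ∑ m ∈ ((unitIndices n).erase k₀).image ρ, cosecSq n (m : ℕ) := by
            rw [Finset.mul_sum, Finset.sum_image]
            intro k hk l hl
            exact hρinj k (Finset.mem_of_mem_erase hk) l (Finset.mem_of_mem_erase hl)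
        _ ≤ _ := by
            refine mul_le_mul_of_nonneg_left ?_ (abs_nonneg _)
            exact Finset.sum_le_sum_of_subset_of_nonneg hsub fun _ _ _ => cosecSq_nonneg _ _
    have hlt := mul_lt_mul_of_pos_left (sum_cosecSq_lt hn) hq₀
    have heq : |∑ k ∈ (unitIndices n).erase k₀, (q k : ℝ) * cosecSq n (j * k : ℕ)| =
        |(q k₀ : ℝ)| * cosecSq n 1 := by
      rw [eq_neg_of_add_eq_zero_right hsum, abs_neg, abs_mul, abs_of_nonneg (cosecSq_nonneg _ _),
        Nat.cast_one]
    linarith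
  rw [Fintype.linearIndependent_iff]
  intro q hq k
  have h₁ := key (fun k => if h : k ∈ unitIndices n then q ⟨k, h⟩ else 0) (by
    rw [← Finset.sum_coe_sort, ← hq]
    refine Finset.sum_congr rfl fun k _ => ?_
    simp [Rat.smul_def]) k k.2
  simpa using h₁

end

end AffineExchange

/-! ### The real subfield of the cyclotomic field. -/

namespace AffineExchange

open Real Filter

noncomputable section

open scoped IntermediateField

/-- A primitive root of unity of order `2 (2 n + 1)`. -/
def rootOfUnity (n : ℕ) : ℂ := Complex.exp (2 * π * Complex.I / (2 * (2 * n + 1) : ℕ))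

theorem isPrimitiveRoot_rootOfUnity (n : ℕ) : IsPrimitiveRoot (rootOfUnity n) (2 * (2 * n + 1)) :=
  Complex.isPrimitiveRoot_exp _ (by omega)

theorem rootOfUnity_pow (n k : ℕ) :
    rootOfUnity n ^ k = Complex.exp ((k * unitAngle n : ℝ) * Complex.I) := by
  rw [rootOfUnity, ← Complex.exp_nat_mul, unitAngle]
  congr 1
  push_cast
  field_simp

/-- The field of real numbers in the cyclotomic field of order `2 (2 n + 1)`. -/
def realCyclotomic (n : ℕ) : IntermediateField ℚ ℝ :=
  ℚ⟮rootOfUnity n⟯.comap (Complex.ofRealAm.restrictScalars ℚ)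

theorem mem_realCyclotomic {n : ℕ} {x : ℝ} :
    x ∈ realCyclotomic n ↔ (x : ℂ) ∈ ℚ⟮rootOfUnity n⟯ := Iff.rfl

theorem cos_mem_realCyclotomic (n k : ℕ) : cos (k * unitAngle n) ∈ realCyclotomic n := by
  have h : rootOfUnity n ^ k ∈ ℚ⟮rootOfUnity n⟯ :=
    pow_mem (IntermediateField.mem_adjoin_simple_self ℚ _) k
  have e : ((cos (k * unitAngle n) : ℝ) : ℂ) = (rootOfUnity n ^ k + (rootOfUnity n ^ k)⁻¹) / 2 := by
    rw [rootOfUnity_pow, ← Complex.exp_neg, Complex.ofReal_cos, Complex.cos, neg_mul]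
  rw [mem_realCyclotomic, e]
  exact div_mem (add_mem h (inv_mem h)) (ofNat_mem _ 2)

/-- A single sine involves the factor i, which need not lie in the field; in a product of two sines
it disappears. -/
theorem sin_mul_sin_mem_realCyclotomic (n k l : ℕ) :
    sin (k * unitAngle n) * sin (l * unitAngle n) ∈ realCyclotomic n := by
  have h : ∀ k, rootOfUnity n ^ k ∈ ℚ⟮rootOfUnity n⟯ := fun k =>
    pow_mem (IntermediateField.mem_adjoin_simple_self ℚ _) k
  have e : ∀ k : ℕ, ((sin (k * unitAngle n) : ℝ) : ℂ) =
      ((rootOfUnity n ^ k)⁻¹ - rootOfUnity n ^ k) * Complex.I / 2 := by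
    intro k
    rw [rootOfUnity_pow, ← Complex.exp_neg, Complex.ofReal_sin, Complex.sin, neg_mul]
  have e' : ((sin (k * unitAngle n) * sin (l * unitAngle n) : ℝ) : ℂ) =
      -(((rootOfUnity n ^ k)⁻¹ - rootOfUnity n ^ k) *
        ((rootOfUnity n ^ l)⁻¹ - rootOfUnity n ^ l) / 4) := by
    rw [Complex.ofReal_mul, e, e]
    linear_combination (((rootOfUnity n ^ k)⁻¹ - rootOfUnity n ^ k) *
        ((rootOfUnity n ^ l)⁻¹ - rootOfUnity n ^ l) / 4) * Complex.I_sq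
  rw [mem_realCyclotomic, e']
  exact neg_mem (div_mem (mul_mem (sub_mem (inv_mem (h k)) (h k)) (sub_mem (inv_mem (h l)) (h l)))
    (ofNat_mem _ 4))

theorem increment_mem_realCyclotomic (n a b : ℕ) : increment n a b ∈ realCyclotomic n := by
  have h := div_mem (cos_mem_realCyclotomic n b) (sin_mul_sin_mem_realCyclotomic n a (a + b))
  rwa [Nat.cast_add, add_mul] at h

/-- As 2n + 1 is odd, φ(2(2n+1)) = φ(2n+1). -/
theorem finrank_adjoin_rootOfUnity (n : ℕ) :
    Module.finrank ℚ ℚ⟮rootOfUnity n⟯ = Nat.totient (2 * n + 1) := by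
  have h := isPrimitiveRoot_rootOfUnity n
  rw [IntermediateField.adjoin.finrank (h.isIntegral (by omega)).tower_top,
    ← Polynomial.cyclotomic_eq_minpoly_rat h (by omega), Polynomial.natDegree_cyclotomic,
    Nat.totient_mul (by simp), Nat.totient_two, one_mul]

/-- For the non-real root of unity η, the map (x, y) ↦ x + ηy embeds two copies of the real subfield
into ℚ(η). -/
theorem finite_realCyclotomic {n : ℕ} (hn : 1 ≤ n) : Module.Finite ℚ (realCyclotomic n) ∧
    2 * Module.finrank ℚ (realCyclotomic n) ≤ Nat.totient (2 * n + 1) := by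
  have h := isPrimitiveRoot_rootOfUnity n
  have hη : (rootOfUnity n).im ≠ 0 := by
    have := rootOfUnity_pow n 1
    rw [pow_one, Nat.cast_one, one_mul] at this
    rw [this, Complex.exp_ofReal_mul_I_im]
    refine (sin_pos_of_pos_of_lt_pi (unitAngle_pos n) ?_).ne'
    have := mul_unitAngle_lt hn
    rw [Nat.cast_one, one_mul] at this
    linarith [pi_pos]
  have : Module.Finite ℚ ℚ⟮rootOfUnity n⟯ :=
    IntermediateField.adjoin.finiteDimensional (h.isIntegral (by omega)).tower_top
  let g : realCyclotomic n →ₗ[ℚ] ℚ⟮rootOfUnity n⟯ :=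
    { toFun := fun x => ⟨(x : ℝ), x.2⟩
      map_add' := fun x y => Subtype.ext (by simp)
      map_smul' := fun q x => Subtype.ext (by simp [Algebra.smul_def]) }
  let m : ℚ⟮rootOfUnity n⟯ →ₗ[ℚ] ℚ⟮rootOfUnity n⟯ :=
    LinearMap.mulLeft ℚ (IntermediateField.AdjoinSimple.gen ℚ (rootOfUnity n))
  -- The imaginary part of x + ηy is y Im η, which gives y = 0; then the real part gives x = 0.
  have hinj : Function.Injective (g.coprod (m ∘ₗ g)) := by
    rw [injective_iff_map_eq_zero]
    rintro ⟨x, y⟩ hxy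
    have hc : ((x : ℝ) : ℂ) + rootOfUnity n * ((y : ℝ) : ℂ) = 0 := congrArg Subtype.val hxy
    have him := congrArg Complex.im hc
    have hre := congrArg Complex.re hc
    simp [hη] at him
    simp [him] at hre
    simp [him, hre]
  have hginj : Function.Injective g := fun x y hxy => by
    have : ((x : ℝ) : ℂ) = (y : ℝ) := congrArg Subtype.val hxy
    exact Subtype.ext (by exact_mod_cast this)
  have hfin : Module.Finite ℚ (realCyclotomic n) := Module.Finite.of_injective g hginj
  refine ⟨hfin, ?_⟩
  have := LinearMap.finrank_le_finrank_of_injective hinj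
  rw [Module.finrank_prod, finrank_adjoin_rootOfUnity] at this
  omega

end

end AffineExchange

/-! ### The group of periods and its rank. -/

namespace AffineExchange

open Real Filter

noncomputable section

/-- The parameters of the initial seed. -/
def initialParam (n : ℕ) : SeedParam := ⟨true, 1, n, 0⟩

theorem initialParam_valid {n : ℕ} (hn : 1 ≤ n) : (initialParam n).Valid n :=
  ⟨le_rfl, hn, le_rfl⟩

theorem SeedParam.shift_zero (s : SeedParam) : s.shift 0 = s := by
  simp [SeedParam.shift]

theorem SeedParam.shift_shift (u v : ℝ) (s : SeedParam) :
    (s.shift v).shift u = s.shift (u + v) := by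
  simp only [SeedParam.shift]
  congr 1
  ring

/-- The shifts that preserve the parameters of the vertices of the exchange graph. -/
def periods (n : ℕ) (K : ℝ) : AddSubgroup ℝ where
  carrier := {u | Relation.ReflTransGen (Step n K) (initialParam n) ((initialParam n).shift u)}
  zero_mem' := by
    rw [Set.mem_ofPred_eq, SeedParam.shift_zero]
  add_mem' := by
    intro u v hu hv
    have h := reflTransGen_step_shift v hu
    rw [SeedParam.shift_shift, add_comm] at h
    exact Relation.ReflTransGen.trans hv h
  neg_mem' := by
    intro u hu
    have h := reflTransGen_step_symm (reflTransGen_step_shift (-u) hu)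
    rwa [SeedParam.shift_shift, neg_add_cancel, SeedParam.shift_zero] at h

/-- The path from the initial seed to s, shifted by u and reversed, leads from the shifted s to the
shifted initial seed. Hence the periods can be found at any reachable seed. -/
theorem mem_periods_of_shift {n : ℕ} {K u : ℝ} {s : SeedParam}
    (hs : Relation.ReflTransGen (Step n K) (initialParam n) s)
    (hu : Relation.ReflTransGen (Step n K) (initialParam n) (s.shift u)) : u ∈ periods n K :=
  hu.trans (reflTransGen_step_symm (reflTransGen_step_shift u hs))

theorem reflTransGen_shift_of_mem_periods {n : ℕ} {K u : ℝ} {s : SeedParam} (hu : u ∈ periods n K)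
    (hs : Relation.ReflTransGen (Step n K) (initialParam n) s) :
    Relation.ReflTransGen (Step n K) (initialParam n) (s.shift u) :=
  Relation.ReflTransGen.trans hu (reflTransGen_step_shift u hs)

/-- The differences of positions lie in each group that contains the increments. -/
theorem sub_mem_of_reflTransGen {n : ℕ} {K : ℝ} {H : AddSubgroup ℝ}
    (hH : ∀ a ≤ n, ∀ b ≤ n, K * increment n a b ∈ H) {s t : SeedParam}
    (h : Relation.ReflTransGen (Step n K) s t) : t.p - s.p ∈ H := by
  have hmove : ∀ {s t : SeedParam}, Move n K s t → t.p - s.p ∈ H := by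
    intro s t h
    cases h with
    | up ε a b p ha hab => simp
    | right ε a b p ha hab => simpa using hH a (by omega) b (by omega)
    | turn ε a b p ha hb hab => simpa using hH a ha b hb
  induction h with
  | refl => simp
  | @tail t u _ h ih =>
    have h' : u.p - t.p ∈ H := by
      rcases h with h | h
      · exact hmove h
      · simpa using neg_mem (hmove h)
    simpa using add_mem h' ih

theorem periods_le {n : ℕ} {K : ℝ} {H : AddSubgroup ℝ}
    (hH : ∀ a ≤ n, ∀ b ≤ n, K * increment n a b ∈ H) : periods n K ≤ H := by
  intro u hu
  simpa [initialParam, SeedParam.shift] using sub_mem_of_reflTransGen hH hu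

/-- Finitely many increments generate a group that contains the periods, and ℤ is noetherian. -/
theorem finite_periods (n : ℕ) (K : ℝ) : Module.Finite ℤ (periods n K) := by
  let S : Set ℝ := (fun x : ℕ × ℕ => K * increment n x.1 x.2) '' (Set.Iic n ×ˢ Set.Iic n)
  have hS : S.Finite := ((Set.finite_Iic n).prod (Set.finite_Iic n)).image _
  have hnoeth := isNoetherian_span_of_finite ℤ hS
  have hle : AddSubgroup.toIntSubmodule (periods n K) ≤ Submodule.span ℤ S := by
    refine periods_le (H := (Submodule.span ℤ S).toAddSubgroup) fun a ha b hb => ?_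
    exact Submodule.subset_span ⟨(a, b), ⟨ha, hb⟩, rfl⟩
  have hfg := isNoetherian_submodule.1 hnoeth _ hle
  rw [Submodule.fg_iff_addSubgroup_fg, AddSubgroup.toIntSubmodule_toAddSubgroup] at hfg
  rwa [Module.Finite.iff_addGroup_fg, AddGroup.fg_iff_addSubgroup_fg]

/-- Division by K embeds the periods into the real subfield, and independence over ℤ is independence
over ℚ. -/
theorem two_mul_finrank_periods_le {n : ℕ} (hn : 1 ≤ n) {K : ℝ} (hK : K ≠ 0) :
    2 * Module.finrank ℤ (periods n K) ≤ Nat.totient (2 * n + 1) := by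
  obtain ⟨hfin, hle⟩ := finite_realCyclotomic hn
  have := finite_periods n K
  have hmem : ∀ u ∈ periods n K, K⁻¹ * u ∈ realCyclotomic n := by
    intro u hu
    refine periods_le (H := (realCyclotomic n).toSubfield.toAddSubgroup.comap
      (AddMonoidHom.mulLeft K⁻¹)) (fun a _ b _ => ?_) hu
    change K⁻¹ * (K * increment n a b) ∈ realCyclotomic n
    rw [inv_mul_cancel_left₀ hK]
    exact increment_mem_realCyclotomic n a b
  let g : periods n K →+ realCyclotomic n :=
    { toFun := fun u => ⟨K⁻¹ * u, hmem u u.2⟩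
      map_zero' := Subtype.ext (by simp)
      map_add' := fun u v => Subtype.ext (by simp [mul_add]) }
  have hg : Function.Injective g := fun u v h => by
    have h' : K⁻¹ * (u : ℝ) = K⁻¹ * v := congrArg Subtype.val h
    exact Subtype.ext (mul_left_cancel₀ (inv_ne_zero hK) h')
  have hli := (Module.finBasis ℤ (periods n K)).linearIndependent.map'
    g.toIntLinearMap (LinearMap.ker_eq_bot.2 hg)
  rw [LinearIndependent.iff_fractionRing ℤ ℚ] at hli
  have := hli.fintype_card_le_finrank
  rw [Fintype.card_fin] at this
  omega

/-- Seeds with the given orientation and angles occur in the exchange graph. -/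
def Occurs (n : ℕ) (K : ℝ) (ε : Bool) (a b : ℕ) : Prop :=
  ∃ p, Relation.ReflTransGen (Step n K) (initialParam n) ⟨ε, a, b, p⟩

theorem occurs_up_iff {n a b : ℕ} {K : ℝ} {ε : Bool} (ha : 1 ≤ a) (hab : a + b ≤ n) :
    Occurs n K ε a (a + b) ↔ Occurs n K ε a b :=
  ⟨fun ⟨p, h⟩ => ⟨p, h.tail (Or.inr (.up ε a b p ha hab))⟩,
    fun ⟨p, h⟩ => ⟨p, h.tail (Or.inl (.up ε a b p ha hab))⟩⟩

theorem occurs_right_iff {n a b : ℕ} {K : ℝ} {ε : Bool} (ha : 1 ≤ a) (hab : a + b ≤ n) :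
    Occurs n K ε (a + b) b ↔ Occurs n K ε a b := by
  refine ⟨fun ⟨p, h⟩ => ⟨p + K * increment n a b, h.tail (Or.inr ?_)⟩,
    fun ⟨p, h⟩ => ⟨_, h.tail (Or.inl (.right ε a b p ha hab))⟩⟩
  have := Move.right (K := K) ε a b (p + K * increment n a b) ha hab
  rwa [add_sub_cancel_right] at this

theorem occurs_turn_iff {n a b : ℕ} {K : ℝ} {ε : Bool} (ha : a ≤ n) (hb : b ≤ n)
    (hab : n + 1 ≤ a + b) :
    Occurs n K (!ε) (2 * n + 1 - (a + b)) a ↔ Occurs n K ε a b := by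
  refine ⟨fun ⟨p, h⟩ => ⟨p + K * increment n a b, h.tail (Or.inr ?_)⟩,
    fun ⟨p, h⟩ => ⟨_, h.tail (Or.inl (.turn ε a b p ha hb hab))⟩⟩
  have := Move.turn (K := K) ε a b (p + K * increment n a b) ha hb hab
  rwa [add_sub_cancel_right] at this

/-- The Euclidean algorithm on the angles. -/
theorem occurs_iff_of_coprime {n : ℕ} {K : ℝ} {ε : Bool} : ∀ {a b : ℕ}, 1 ≤ a → a ≤ n → b ≤ n →
    a.Coprime b → (Occurs n K ε a b ↔ Occurs n K ε 1 0) := by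
  intro a b
  induction h : a + b using Nat.strong_induction_on generalizing a b with
  | _ m ih =>
    subst h
    intro h₁ h₂ h₃ hc
    rcases Nat.eq_zero_or_pos b with rfl | hb
    · rw [Nat.coprime_zero_right] at hc
      rw [hc]
    rcases le_or_gt a b with hab | hab
    · obtain ⟨c, rfl⟩ := Nat.exists_eq_add_of_le hab
      rw [occurs_up_iff h₁ h₃]
      exact ih (a + c) (by omega) rfl h₁ h₂ (by omega) (by simpa using hc)
    · obtain ⟨c, rfl⟩ := Nat.exists_eq_add_of_le' hab.le
      rw [occurs_right_iff (by omega) h₂]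
      exact ih (c + b) (by omega) rfl (by omega) (by omega) h₃ (by simpa using hc)

/-- The Euclidean algorithm preserves the orientation; one turn, from (1, n) to (n, 1), supplies the
other one. -/
theorem occurs_one_zero {n : ℕ} (hn : 1 ≤ n) (K : ℝ) (ε : Bool) : Occurs n K ε 1 0 := by
  have h : Occurs n K true 1 n := ⟨0, Relation.ReflTransGen.refl⟩
  cases ε
  · rw [← occurs_turn_iff hn le_rfl (by omega)] at h
    rwa [occurs_iff_of_coprime (by omega) (by omega) hn (by simp)] at h
  · rwa [occurs_iff_of_coprime le_rfl hn le_rfl (by simp)] at h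

theorem occurs_mul_iff {n k : ℕ} {K : ℝ} {ε : Bool} (hk : 1 ≤ k) :
    ∀ l, k * l ≤ n → (Occurs n K ε k (k * l) ↔ Occurs n K ε k 0) := by
  intro l
  induction l with
  | zero => simp
  | succ l ih =>
    intro h
    rw [mul_add, mul_one, add_comm] at h ⊢
    rw [occurs_up_iff hk h, ih (by omega)]

/-- From (k, 0) the moves `up` lead to (k, kl) with l = n / k, the largest multiple of k in range. A
turn then gives (2n + 1 - (k + kl), k), whose gcd is that of 2n + 1 and k, so the Euclidean
algorithm ends at (1, 0). -/
theorem occurs_zero_of_coprime {n k : ℕ} (hk : 1 ≤ k) (hkn : k ≤ n) (hc : (2 * n + 1).Coprime k)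
    (K : ℝ) (ε : Bool) : Occurs n K ε k 0 := by
  have h₁ : k * (n / k) ≤ n := Nat.mul_div_le n k
  have h₂ : n < k + k * (n / k) := by
    have := Nat.lt_mul_div_succ n hk
    rw [mul_add] at this
    omega
  rw [← occurs_mul_iff hk _ h₁, ← occurs_turn_iff hkn h₁ h₂,
    occurs_iff_of_coprime (by omega) (by omega) hkn]
  · exact occurs_one_zero (by omega) K _
  · rw [show k + k * (n / k) = (1 + n / k) * k by ring]
    rw [Nat.coprime_iff_gcd_eq_one, Nat.gcd_sub_mul_right_left]
    · exact hc
    · rw [add_mul, one_mul, mul_comm]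
      omega

/-- For b = 0 the move `right` fixes the angles and only shifts the position. -/
theorem mul_cosecSq_mem_periods {n k : ℕ} (K : ℝ) (hk : k ∈ unitIndices n) :
    K * cosecSq n (k : ℕ) ∈ periods n K := by
  simp only [unitIndices, Finset.mem_filter, Finset.mem_Icc] at hk
  obtain ⟨⟨h₁, h₂⟩, h₃⟩ := hk
  obtain ⟨p, hp⟩ := occurs_zero_of_coprime h₁ h₂ h₃ K true
  have h : -(K * increment n k 0) ∈ periods n K :=
    mem_periods_of_shift hp (hp.tail (Or.inl (Move.right true k 0 p h₁ h₂)))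
  have e : cosecSq n (k : ℕ) = increment n k 0 := by
    simp [cosecSq, increment, sq]
  rw [e]
  exact neg_mem_iff.1 h

theorem totient_le_two_mul_finrank_periods {n : ℕ} (hn : 1 ≤ n) {K : ℝ} (hK : K ≠ 0) :
    Nat.totient (2 * n + 1) ≤ 2 * Module.finrank ℤ (periods n K) := by
  have := finite_periods n K
  have h₁ := (linearIndependent_cosecSq hn).map' (LinearMap.mulLeft ℚ K)
    (LinearMap.ker_eq_bot.2 (mul_right_injective₀ hK))
  rw [← LinearIndependent.iff_fractionRing ℤ ℚ] at h₁
  let v : unitIndices n → periods n K := fun k =>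
    ⟨K * cosecSq n (k : ℕ), mul_cosecSq_mem_periods K k.2⟩
  have h₂ : LinearIndependent ℤ v :=
    LinearIndependent.of_comp (periods n K).subtype.toIntLinearMap h₁
  have h₃ := h₂.fintype_card_le_finrank
  rw [Fintype.card_coe] at h₃
  rw [← two_mul_card_unitIndices hn]
  omega

theorem finrank_periods {n : ℕ} (hn : 1 ≤ n) {K : ℝ} (hK : K ≠ 0) :
    Module.finrank ℤ (periods n K) = Nat.totient (2 * n + 1) / 2 := by
  have h₁ := two_mul_finrank_periods_le hn hK
  have h₂ := totient_le_two_mul_finrank_periods hn hK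
  omega

end

end AffineExchange

/-! ### The action of the periods on the exchange graph. -/

namespace AffineExchange

open Real Filter

noncomputable section

theorem dist_iso {M N : Type*} {G : SimpleGraph M} {H : SimpleGraph N} (hG : G.Connected)
    (hH : H.Connected) (f : G ≃g H) (x y : M) : H.dist (f x) (f y) = G.dist x y := by
  refine le_antisymm ?_ ?_
  · have := dist_map_le_mul_dist hG hH f 1 (fun x y h =>
      (SimpleGraph.dist_eq_one_iff_adj.2 (f.map_adj_iff.2 h)).le) x y
    rwa [one_mul] at this
  · have := dist_map_le_mul_dist hH hG f.symm 1 (fun x y h =>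
      (SimpleGraph.dist_eq_one_iff_adj.2 (f.symm.map_adj_iff.2 h)).le) (f x) (f y)
    rwa [one_mul, RelIso.symm_apply_apply, RelIso.symm_apply_apply] at this

namespace BeltFrame

variable {T : Affine.Triangle ℝ Plane} (F : BeltFrame T) {n : ℕ}

theorem norm_e : ‖F.e‖ = 1 := by
  rw [norm_eq_sqrt_real_inner, F.inner_e_e, sqrt_one]

theorem exists_param (hn : 1 ≤ n) (h₀ : initialSeed n T = F.seedOf n (initialParam n))
    (x : ExchangeVertex n T) : ∃ s, s.Valid n ∧
      Relation.ReflTransGen (Step n F.K) (initialParam n) s ∧ x.1 = F.seedOf n s := by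
  obtain ⟨x, hx⟩ := x
  rw [h₀] at hx
  exact (F.reflTransGen_isMutation_iff (initialParam_valid hn) _).1 hx

theorem reachable_of_param (hn : 1 ≤ n) (h₀ : initialSeed n T = F.seedOf n (initialParam n))
    {s : SeedParam} (hs : s.Valid n)
    (hs' : Relation.ReflTransGen (Step n F.K) (initialParam n) s) :
    Relation.ReflTransGen (IsMutation T) (initialSeed n T) (F.seedOf n s) := by
  rw [h₀]
  exact (F.reflTransGen_isMutation_iff (initialParam_valid hn) _).2 ⟨s, hs, hs', rfl⟩

/-- Translations between seeds are multiples u e with u a period. L is generated by the lengths |u|,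
and a subgroup contains u exactly when it contains |u|. -/
theorem translationLattice_eq (hn : 1 ≤ n)
    (h₀ : initialSeed n T = F.seedOf n (initialParam n)) :
    translationLattice n T = periods n F.K := by
  refine le_antisymm ((AddSubgroup.closure_le _).2 ?_) fun u hu => ?_
  · rintro _ ⟨w, x, y, hxy, rfl⟩
    obtain ⟨s, hs, hs', hx⟩ := F.exists_param hn h₀ x
    obtain ⟨t, ht, ht', hy⟩ := F.exists_param hn h₀ y
    rw [hx, hy] at hxy
    obtain ⟨h₁, h₂⟩ := F.eq_shift_of_seedOf_eq_translate hs ht hxy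
    rw [h₂, norm_smul, F.norm_e, mul_one, Real.norm_eq_abs]
    rw [h₁] at hs'
    have hmem : s.p - t.p ∈ periods n F.K := mem_periods_of_shift ht' hs'
    rcases abs_choice (s.p - t.p) with h | h <;> rw [h]
    · exact hmem
    · exact neg_mem hmem
  · have hmem : |u| ∈ translationLattice n T := by
      refine AddSubgroup.subset_closure ⟨u • F.e, ⟨F.seedOf n ((initialParam n).shift u),
        F.reachable_of_param hn h₀ (initialParam_valid hn) hu⟩, initialVertex n T, ?_, ?_⟩
      · exact (F.translate_seedOf n u (initialParam n)).symm.trans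
          (congrArg (translate (u • F.e)) h₀.symm)
      · rw [norm_smul, F.norm_e, mul_one, Real.norm_eq_abs]
    rcases abs_choice u with h | h <;> rw [h] at hmem
    · exact hmem
    · exact neg_mem_iff.1 hmem

/-- Symmetry holds because each `Move` is undone by a mutation; it makes every neighbour in Γ one of
the three mutations. -/
theorem isMutation_symm (hn : 1 ≤ n) (h₀ : initialSeed n T = F.seedOf n (initialParam n))
    {x y : ExchangeVertex n T} (h : IsMutation T x.1 y.1) : IsMutation T y.1 x.1 := by
  obtain ⟨s, hs, -, hx⟩ := F.exists_param hn h₀ x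
  rw [hx] at h ⊢
  obtain ⟨t, hst, hy⟩ := (F.isMutation_seedOf_iff hs _).1 h
  rw [hy]
  exact (F.isMutation_seedOf_iff hst.valid _).2 ⟨s, hst.symm, rfl⟩

theorem finite_adj (hn : 1 ≤ n) (h₀ : initialSeed n T = F.seedOf n (initialParam n))
    (x : ExchangeVertex n T) : {y | (exchangeGraph n T).Adj x y}.Finite := by
  obtain ⟨s, hs⟩ := Quotient.exists_rep x.1
  refine ((Set.finite_range fun k => (Quotient.mk _ (s.mutate T k) : Seed)).preimage
    (f := Subtype.val) Subtype.val_injective.injOn |>.subset fun y hy => ?_)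
  have hxy : IsMutation T x.1 y.1 :=
    ((SimpleGraph.fromRel_adj (fun x y : ExchangeVertex n T => IsMutation T x.1 y.1) x y).1
      hy).2.elim id (F.isMutation_symm hn h₀)
  rw [← hs] at hxy
  obtain ⟨k, hk⟩ := (isMutation_mk_iff _ _).1 hxy
  exact ⟨k, hk.symm⟩

/-- Translation of a vertex of the exchange graph. -/
def translateVertex (hn : 1 ≤ n) (h₀ : initialSeed n T = F.seedOf n (initialParam n))
    (u : periods n F.K) (x : ExchangeVertex n T) : ExchangeVertex n T :=
  ⟨translate ((u : ℝ) • F.e) x.1, by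
    obtain ⟨s, hs, hs', hx⟩ := F.exists_param hn h₀ x
    rw [hx, translate_seedOf]
    exact F.reachable_of_param hn h₀ hs (reflTransGen_shift_of_mem_periods u.2 hs')⟩

variable (hn : 1 ≤ n) (h₀ : initialSeed n T = F.seedOf n (initialParam n))

theorem translateVertex_val (u : periods n F.K) (x : ExchangeVertex n T) :
    (F.translateVertex hn h₀ u x).1 = translate ((u : ℝ) • F.e) x.1 := rfl

theorem translateVertex_zero (x : ExchangeVertex n T) : F.translateVertex hn h₀ 0 x = x := by
  obtain ⟨s, hs, hs', hx⟩ := F.exists_param hn h₀ x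
  refine Subtype.ext ?_
  rw [translateVertex_val, hx, translate_seedOf, AddSubgroup.coe_zero, SeedParam.shift_zero]

theorem translateVertex_add (u v : periods n F.K) (x : ExchangeVertex n T) :
    F.translateVertex hn h₀ (u + v) x =
      F.translateVertex hn h₀ u (F.translateVertex hn h₀ v x) := by
  obtain ⟨s, hs, hs', hx⟩ := F.exists_param hn h₀ x
  refine Subtype.ext ?_
  rw [translateVertex_val, translateVertex_val, translateVertex_val, hx, translate_seedOf,
    translate_seedOf, translate_seedOf, SeedParam.shift_shift, AddSubgroup.coe_add]

theorem isMutation_translateVertex (u : periods n F.K) {x y : ExchangeVertex n T}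
    (h : IsMutation T x.1 y.1) :
    IsMutation T (F.translateVertex hn h₀ u x).1 (F.translateVertex hn h₀ u y).1 := by
  obtain ⟨s, hs, -, hx⟩ := F.exists_param hn h₀ x
  rw [hx] at h
  obtain ⟨t, hst, hy⟩ := (F.isMutation_seedOf_iff hs _).1 h
  rw [translateVertex_val, translateVertex_val, hx, hy, translate_seedOf, translate_seedOf]
  exact (F.isMutation_seedOf_iff (s := s.shift u) hs _).2 ⟨_, hst.shift u, rfl⟩

/-- Translations act on the vertices of the exchange graph by permutations. -/
def translateEquiv (u : periods n F.K) : ExchangeVertex n T ≃ ExchangeVertex n T where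
  toFun := F.translateVertex hn h₀ u
  invFun := F.translateVertex hn h₀ (-u)
  left_inv x := by rw [← translateVertex_add, neg_add_cancel, translateVertex_zero]
  right_inv x := by rw [← translateVertex_add, add_neg_cancel, translateVertex_zero]

theorem isMutation_translateVertex_iff (u : periods n F.K) {x y : ExchangeVertex n T} :
    IsMutation T (F.translateVertex hn h₀ u x).1 (F.translateVertex hn h₀ u y).1 ↔
      IsMutation T x.1 y.1 := by
  refine ⟨fun h => ?_, F.isMutation_translateVertex hn h₀ u⟩
  have h' := F.isMutation_translateVertex hn h₀ (-u) h
  rwa [← translateVertex_add, ← translateVertex_add, neg_add_cancel, translateVertex_zero,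
    translateVertex_zero] at h'

/-- Translations act on the exchange graph by automorphisms. -/
def translateIso (u : periods n F.K) : exchangeGraph n T ≃g exchangeGraph n T where
  toEquiv := F.translateEquiv hn h₀ u
  map_rel_iff' {x y} := by
    rw [exchangeGraph, SimpleGraph.fromRel_adj, SimpleGraph.fromRel_adj]
    refine and_congr (F.translateEquiv hn h₀ u).injective.ne_iff (or_congr ?_ ?_) <;>
      exact F.isMutation_translateVertex_iff hn h₀ u

/-- The action of the periods on the exchange graph. -/
def translateHom :
    Multiplicative (periods n F.K) →* (exchangeGraph n T ≃g exchangeGraph n T) where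
  toFun u := F.translateIso hn h₀ u.toAdd
  map_one' := RelIso.ext fun x => F.translateVertex_zero hn h₀ x
  map_mul' u v := RelIso.ext fun x => F.translateVertex_add hn h₀ u.toAdd v.toAdd x

/-- The action is free. Together with the finiteness of balls this makes it properly discontinuous.
-/
theorem translateVertex_injective (x : ExchangeVertex n T) :
    Function.Injective fun u => F.translateVertex hn h₀ u x := by
  intro u v h
  obtain ⟨s, hs, -, hx⟩ := F.exists_param hn h₀ x
  have h' := congrArg Subtype.val h
  simp only [translateVertex_val, hx] at h'
  rw [translate_seedOf] at h'
  have h₁ := (F.eq_shift_of_seedOf_eq_translate (s := s.shift u) hs hs h').2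
  have h₂ := congrArg (fun z => inner ℝ z F.e) h₁
  simp only [inner_smul_left, F.inner_e_e, SeedParam.shift] at h₂
  exact Subtype.ext (by simpa using h₂.symm)

theorem finite_setOf_dist_translateVertex_le (x : ExchangeVertex n T) (m : ℕ) :
    {u : periods n F.K |
      (exchangeGraph n T).dist x (F.translateVertex hn h₀ u x) ≤ m}.Finite :=
  (finite_ball (exchangeGraph_connected n T) (F.finite_adj hn h₀) x m).preimage
    (F.translateVertex_injective hn h₀ x).injOn

/-- There are finitely many orbits of vertices. -/
theorem exists_finite_orbit_representatives :
    ∃ R : Set (ExchangeVertex n T), R.Finite ∧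
      ∀ x, ∃ y ∈ R, ∃ u : periods n F.K, F.translateVertex hn h₀ u y = x := by
  classical
  -- Orbits correspond to the triples (ε, a, b) that occur. One vertex is chosen for each triple;
  -- the arbitrary choice for the others does no harm.
  let P : Bool × Fin (n + 1) × Fin (n + 1) → ExchangeVertex n T → Prop := fun c y =>
    ∃ p, Relation.ReflTransGen (Step n F.K) (initialParam n) ⟨c.1, c.2.1, c.2.2, p⟩ ∧
      y.1 = F.seedOf n ⟨c.1, c.2.1, c.2.2, p⟩
  have : Nonempty (ExchangeVertex n T) := ⟨initialVertex n T⟩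
  refine ⟨Set.range fun c => Classical.epsilon (P c), Set.finite_range _, fun x => ?_⟩
  obtain ⟨s, hs, hs', hx⟩ := F.exists_param hn h₀ x
  let c : Bool × Fin (n + 1) × Fin (n + 1) :=
    (s.ε, ⟨s.a, Nat.lt_succ_of_le hs.2.1⟩, ⟨s.b, Nat.lt_succ_of_le hs.2.2⟩)
  obtain ⟨p, hp, hy⟩ := Classical.epsilon_spec (p := P c) ⟨x, s.p, hs', hx⟩
  have hshift : s = SeedParam.shift (s.p - p) ⟨s.ε, s.a, s.b, p⟩ := by
    simp [SeedParam.shift]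
  refine ⟨_, ⟨c, rfl⟩, ⟨s.p - p, mem_periods_of_shift hp ?_⟩, Subtype.ext ?_⟩
  · exact hshift ▸ hs'
  · rw [translateVertex_val]
    refine (congrArg (translate _) hy).trans ?_
    rw [translate_seedOf, hx]
    exact congrArg (F.seedOf n) hshift.symm

end BeltFrame

end

end AffineExchange

theorem corollary5p5 (n : ℕ) (hn : 1 ≤ n)
    (T : Affine.Triangle ℝ AffineExchange.Plane) (hT : AffineExchange.IsInitialTriangle n T) :
    -- translations by elements of `L` form an action of `L` on `Γ` by graph automorphisms
    ∃ τ : Multiplicative (AffineExchange.translationLattice n T) →*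
        (AffineExchange.exchangeGraph n T ≃g AffineExchange.exchangeGraph n T),
      (∀ (w : AffineExchange.translationLattice n T) (x : AffineExchange.ExchangeVertex n T),
        (τ (Multiplicative.ofAdd w) x).1 =
          AffineExchange.translate ((w : ℝ) • AffineExchange.beltDirection T) x.1) ∧
      -- the action is isometric
      (∀ (w : AffineExchange.translationLattice n T) (x y : AffineExchange.ExchangeVertex n T),
        AffineExchange.graphDist (AffineExchange.exchangeGraph n T)
            (τ (Multiplicative.ofAdd w) x) (τ (Multiplicative.ofAdd w) y) =
          AffineExchange.graphDist (AffineExchange.exchangeGraph n T) x y) ∧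
      -- the action is properly discontinuous
      (∀ (x : AffineExchange.ExchangeVertex n T) (r : ℝ),
        {w : AffineExchange.translationLattice n T |
          AffineExchange.graphDist (AffineExchange.exchangeGraph n T) x
            (τ (Multiplicative.ofAdd w) x) ≤ r}.Finite) ∧
      -- the quotient is finite
      (∃ F : Set (AffineExchange.ExchangeVertex n T), F.Finite ∧
        ∀ x, ∃ y ∈ F, ∃ w : AffineExchange.translationLattice n T,
          τ (Multiplicative.ofAdd w) y = x) ∧
      -- `L` is finitely generated, of rank `φ(2n+1)/2`
      Module.Finite ℤ (AffineExchange.translationLattice n T) ∧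
      Module.finrank ℤ (AffineExchange.translationLattice n T) = Nat.totient (2 * n + 1) / 2 ∧
      -- the orbit map of the initial seed is a quasi-isometry from each Cayley graph of `L` to `Γ`
      (∀ S : Set (AffineExchange.translationLattice n T),
        S.Finite → (∀ s ∈ S, -s ∈ S) → 0 ∉ S → AddSubgroup.closure S = ⊤ →
        AffineExchange.IsQuasiIsometry
          (AffineExchange.graphDist (SimpleGraph.addCayley S))
          (AffineExchange.graphDist (AffineExchange.exchangeGraph n T))
          (fun w => τ (Multiplicative.ofAdd w) (AffineExchange.initialVertex n T))) ∧
      -- `Γ` is quasi-isometric to `ℤ^r` for `r = φ(2n+1)/2`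
      ∃ f : AffineExchange.ExchangeVertex n T → (Fin (Nat.totient (2 * n + 1) / 2) → ℤ),
        AffineExchange.IsQuasiIsometry
          (AffineExchange.graphDist (AffineExchange.exchangeGraph n T))
          (AffineExchange.graphDist
            (AffineExchange.integerLatticeGraph (Nat.totient (2 * n + 1) / 2)))
          f := by
  open AffineExchange in
  obtain ⟨F, he, h₀⟩ := exists_beltFrame hn hT
  change initialSeed n T = F.seedOf n (initialParam n) at h₀
  have hL := F.translationLattice_eq hn h₀
  rw [hL, ← he]
  have hG := exchangeGraph_connected n T
  have hfin := finite_periods n F.K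
  have hrank := finrank_periods hn F.K_pos.ne'
  have hisom : ∀ (w : periods n F.K) (x y : ExchangeVertex n T),
      (exchangeGraph n T).dist (F.translateVertex hn h₀ w x) (F.translateVertex hn h₀ w y) =
        (exchangeGraph n T).dist x y :=
    fun w => dist_iso hG hG (F.translateIso hn h₀ w)
  have horb := F.exists_finite_orbit_representatives hn h₀
  refine ⟨F.translateHom hn h₀, fun _ _ => rfl, fun w x y => congrArg Nat.cast (hisom w x y),
    fun x r => ?_, horb, hfin, hrank, fun S hS _ _ hgen => ?_, ?_⟩
  · refine (F.finite_setOf_dist_translateVertex_le hn h₀ x ⌊r⌋₊).subset fun w hw => ?_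
    exact Nat.le_floor hw
  · exact (exists_quasiIsometries (addCayley_connected S hgen)
      (fun _ _ _ => SimpleGraph.addCayley_adj_add_iff_right.2) (finite_addCayley_adj_zero S hS) hG
      (F.translateVertex hn h₀) (F.translateVertex_add hn h₀) hisom
      (F.finite_setOf_dist_translateVertex_le hn h₀) horb (initialVertex n T)).1
  -- A basis of L identifies it with ℤ^r, which therefore acts on Γ; the coarse inverse of the orbit
  -- map is the map from Γ to ℤ^r.
  · let φ := (Module.finBasisOfFinrankEq ℤ (periods n F.K) hrank).equivFun.symm
    obtain ⟨R, hR, hR'⟩ := horb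
    refine (exists_quasiIsometries (integerLatticeGraph_connected _) integerLatticeGraph_adj_add
      (finite_integerLatticeGraph_adj_zero _) hG (fun v => F.translateVertex hn h₀ (φ v))
      (fun u v x => ?_) (fun v => hisom (φ v)) (fun x m => ?_) ⟨R, hR, fun x => ?_⟩
      (initialVertex n T)).2
    · rw [map_add, F.translateVertex_add]
    · exact (F.finite_setOf_dist_translateVertex_le hn h₀ x m).preimage φ.injective.injOn
    · obtain ⟨y, hy, w, hw⟩ := hR' x
      exact ⟨y, hy, φ.symm w, by rw [LinearEquiv.apply_symm_apply, hw]⟩
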